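/- **Language and logics.** Formulas are generated by $A ::= p \mid \bot \mid \top \mid A\land A \mid A\lor A \mid A\to A \mid \Box A$ from countably many atoms $p$; $\neg A := A\to\bot$ and $A\leftrightarrow B := (A\to B)\land(B\to A)$. Let $X$ be any set of the following modal axioms and rules: $M$: $\Box(A\land B)\to\Box A$; $C$: $\Box A\land\Box B\to\Box(A\land B)$; $N$: $\Box\top$; $T$: $\Box A\to A$; $P$: $\neg\Box\bot$; $D$: $\neg(\Box A\land\Box\neg A)$; and, for $n\ge 1$, the rule $RD_n^+$: from $\neg(A_1\land\dots\land A_n)$ infer $\neg(\Box A_1\land\dots\land\Box A_n)$. The logic $\mathbf{E}X$ has as theorems the formulas obtained from all instances of classical propositional tautologies by modus ponens, the rule $RE$ (from $A\leftrightarrow B$ infer $\Box A\leftrightarrow\Box B$), and the axioms and rules in $X$. **Hypersequents.** A block is $\langle\Sigma\rangle$ with $\Sigma$ a finite multiset of formulas. A sequent is $\Gamma\Rightarrow\Delta$ with $\Gamma$ a finite multiset of formulas and blocks and $\Delta$ a finite multiset of formulas. A hypersequent $\Gamma_1\Rightarrow\Delta_1\mid\dots\mid\Gamma_k\Rightarrow\Delta_k$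 is a finite multiset of sequents. **The calculus $\mathbf{HE}^*$ for $\mathbf{E}X$.** Each rule is written *premisses* / *conclusion*. Propositional rules (for all $X$): - $\mathsf{init}$: $G\mid p,\Gamma\Rightarrow\Delta,p$ ($p$ an atom); $L\bot$: $G\mid\bot,\Gamma\Rightarrow\Delta$; $R\top$: $G\mid\Gamma\Rightarrow\Delta,\top$ (no premisses); - $L\land$: $G\mid A,B,A\land B,\Gamma\Rightarrow\Delta$ / $G\mid A\land B,\Gamma\Rightarrow\Delta$; $R\land$: $G\mid\Gamma\Rightarrow\Delta,A\land B,A$ and $G\mid\Gamma\Rightarrow\Delta,A\land B,B$ / $G\mid\Gamma\Rightarrow\Delta,A\land B$; - $L\lor$: $G\mid A,A\lor B,\Gamma\Rightarrow\Delta$ and $G\mid B,A\lor B,\Gamma\Rightarrow\Delta$ / $G\mid A\lor B,\Gamma\Rightarrow\Delta$; $R\lor$: $G\mid\Gamma\Rightarrow\Delta,A\lor B,A,B$ / $G\mid\Gamma\Rightarrow\Delta,A\lor B$; - $L{\to}$: $G\mid A\to B,\Gamma\Rightarrow\Delta,A$ and $G\mid B,A\to B,\Gamma\Rightarrow\Delta$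 / $G\mid A\to B,\Gamma\Rightarrow\Delta$; $R{\to}$: $G\mid A,\Gamma\Rightarrow\Delta,A\to B,B$ / $G\mid\Gamma\Rightarrow\Delta,A\to B$. Modal rules: - $L\Box$ (for all $X$): $G\mid\Gamma,\Box A,\langle A\rangle\Rightarrow\Delta$ / $G\mid\Gamma,\Box A\Rightarrow\Delta$; - $R\Box$ (if $M\notin X$): $G\mid\Gamma,\langle\Sigma\rangle\Rightarrow\Box B,\Delta\mid\Sigma\Rightarrow B$ and, for each $A\in\Sigma$, $G\mid\Gamma,\langle\Sigma\rangle\Rightarrow\Box B,\Delta\mid B\Rightarrow A$ / $G\mid\Gamma,\langle\Sigma\rangle\Rightarrow\Box B,\Delta$; - $R\Box\mathsf{m}$ (if $M\in X$): $G\mid\Gamma,\langle\Sigma\rangle\Rightarrow\Box B,\Delta\mid\Sigma\Rightarrow B$ / $G\mid\Gamma,\langle\Sigma\rangle\Rightarrow\Box B,\Delta$; - $\mathsf N$ (if $N\in X$): $G\mid\Gamma,\langle\top\rangle\Rightarrow\Delta$ / $G\mid\Gamma\Rightarrow\Delta$; - $\mathsf C$ (if $C\in X$): $G\mid\Gamma,\langle\Sigma\rangle,\langle\Pi\rangle,\langle\Sigma,\Pi\rangle\Rightarrow\Delta$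 / $G\mid\Gamma,\langle\Sigma\rangle,\langle\Pi\rangle\Rightarrow\Delta$; - $\mathsf T$ (if $T\in X$): $G\mid\Gamma,\langle\Sigma\rangle,\Sigma\Rightarrow\Delta$ / $G\mid\Gamma,\langle\Sigma\rangle\Rightarrow\Delta$; - $\mathsf P$ (if $P\in X$, or both $D,M\in X$): $G\mid\Gamma,\langle\Sigma\rangle\Rightarrow\Delta\mid\Sigma\Rightarrow{}$ / $G\mid\Gamma,\langle\Sigma\rangle\Rightarrow\Delta$; - $\mathsf D_1$ (if $D\in X$, $M\notin X$): $G\mid\Gamma,\langle\Sigma\rangle\Rightarrow\Delta\mid\Sigma\Rightarrow{}$ and, for each $A\in\Sigma$, $G\mid\Gamma,\langle\Sigma\rangle\Rightarrow\Delta\mid{}\Rightarrow A$ / $G\mid\Gamma,\langle\Sigma\rangle\Rightarrow\Delta$; - $\mathsf D_2$ (if $D\in X$, $M\notin X$): $G\mid\Gamma,\langle\Sigma\rangle,\langle\Pi\rangle\Rightarrow\Delta\mid\Sigma,\Pi\Rightarrow{}$ and, for all $A\in\Sigma$, $B\in\Pi$, $G\mid\Gamma,\langle\Sigma\rangle,\langle\Pi\rangle\Rightarrow\Delta\mid{}\Rightarrow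 A,B$ / $G\mid\Gamma,\langle\Sigma\rangle,\langle\Pi\rangle\Rightarrow\Delta$; - $\mathsf D_{\mathsf M}$ (if $D,M\in X$): $G\mid\Gamma,\langle\Sigma\rangle,\langle\Pi\rangle\Rightarrow\Delta\mid\Sigma,\Pi\Rightarrow{}$ / $G\mid\Gamma,\langle\Sigma\rangle,\langle\Pi\rangle\Rightarrow\Delta$; - $\mathsf D_m^+$ (if $RD_n^+\in X$ for some $n$, and $1\le m\le n$): $G\mid\Gamma,\langle\Sigma_1\rangle,\dots,\langle\Sigma_m\rangle\Rightarrow\Delta\mid\Sigma_1,\dots,\Sigma_m\Rightarrow{}$ / $G\mid\Gamma,\langle\Sigma_1\rangle,\dots,\langle\Sigma_m\rangle\Rightarrow\Delta$. **Theorem.** For every such set $X$: 1. (Cut admissibility) the rule $\mathsf{cut}$: $G\mid\Gamma\Rightarrow\Delta,A$ and $G\mid A,\Gamma\Rightarrow\Delta$ / $G\mid\Gamma\Rightarrow\Delta$ is admissible in $\mathbf{HE}^*$: for every formula $A$, if both premisses are derivable in $\mathbf{HE}^*$ then so is the conclusion. 2. (Cut elimination) every hypersequent derivable in $\mathbf{HE}^*$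 extended with $\mathsf{cut}$ is derivable in $\mathbf{HE}^*$. 3. (Syntactic completeness) if $A$ is a theorem of $\mathbf{E}X$, then the hypersequent ${}\Rightarrow A$ is derivable in $\mathbf{HE}^*$. -/

import Mathlib

namespace NNModal

/-- Formulas of the propositional modal language, over countably many atoms. -/
inductive Formula : Type where
  | atom : ℕ → Formula
  | bot : Formula
  | top : Formula
  | and : Formula → Formula → Formula
  | or : Formula → Formula → Formula
  | imp : Formula → Formula → Formula
  | box : Formula → Formula

namespace Formula

/-- Negation `¬A := A → ⊥`. -/
def neg (A : Formula) : Formula := imp A bot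

/-- Equivalence `A ↔ B := (A → B) ∧ (B → A)`. -/
def equiv (A B : Formula) : Formula := and (imp A B) (imp B A)

/-- The conjunction `A₁ ∧ (A₂ ∧ (… ∧ Aₙ))` of a list of formulas
(only used for non-empty lists). -/
def conj : List Formula → Formula
  | [] => top
  | [A] => A
  | A :: B :: l => and A (conj (B :: l))

/-- Truth of a formula under a classical propositional valuation, which chooses freely the truth
values of the atoms (`v`) and of the boxed formulas (`w A` is the value of `□A`). -/
def truth (v : ℕ → Prop) (w : Formula → Prop) : Formula → Prop
  | atom p => v p
  | bot => False
  | top => True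
  | and A B => truth v w A ∧ truth v w B
  | or A B => truth v w A ∨ truth v w B
  | imp A B => truth v w A → truth v w B
  | box A => w A

/-- `A` is an instance, in the modal language, of a theorem of classical propositional logic. -/
def IsTautology (A : Formula) : Prop := ∀ v w, truth v w A

end Formula

open Formula

/-- The modal axioms `M, C, N, T, P, D` and, for each `n ≥ 1`, the rule `RDₙ⁺`. -/
inductive ModalAxiom : Type where
  | M : ModalAxiom
  | C : ModalAxiom
  | N : ModalAxiom
  | T : ModalAxiom
  | P : ModalAxiom
  | D : ModalAxiom
  | RD : ℕ+ → ModalAxiom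

/-- Theorems of the Hilbert system of the logic `EX`: classical propositional logic with modus
ponens, the congruence rule `RE`, and the axioms and rules in `X`. -/
inductive Provable (X : Set ModalAxiom) : Formula → Prop where
  | taut (A : Formula) : IsTautology A → Provable X A
  | mp (A B : Formula) : Provable X (imp A B) → Provable X A → Provable X B
  | re (A B : Formula) : Provable X (equiv A B) → Provable X (equiv (box A) (box B))
  | axM (A B : Formula) : ModalAxiom.M ∈ X → Provable X (imp (box (and A B)) (box A))
  | axC (A B : Formula) : ModalAxiom.C ∈ X →
      Provable X (imp (and (box A) (box B)) (box (and A B)))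
  | axN : ModalAxiom.N ∈ X → Provable X (box top)
  | axT (A : Formula) : ModalAxiom.T ∈ X → Provable X (imp (box A) A)
  | axP : ModalAxiom.P ∈ X → Provable X (neg (box bot))
  | axD (A : Formula) : ModalAxiom.D ∈ X → Provable X (neg (and (box A) (box (neg A))))
  | rd (n : ℕ+) (l : List Formula) : ModalAxiom.RD n ∈ X → l.length = (n : ℕ) →
      Provable X (neg (conj l)) → Provable X (neg (conj (l.map box)))

/-- A block `⟨Σ⟩` is given by a finite multiset `Σ` of formulas. -/
abbrev Block : Type := Multiset Formula

/-- A sequent `Γ ⇒ Δ`, where `Γ` is a multiset of formulas and blocks and `Δ` a multiset of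
formulas. The formulas of `Γ` are collected in `ant`, its blocks in `blk`; `Δ` is `suc`. -/
structure Sequent : Type where
  ant : Multiset Formula
  blk : Multiset Block
  suc : Multiset Formula

/-- A hypersequent `Γ₁ ⇒ Δ₁ | … | Γₖ ⇒ Δₖ` is a finite multiset of sequents, its components.
The hypersequent `G | S` is written `S ::ₘ G`. -/
abbrev Hypersequent : Type := Multiset Sequent

/-- Rule instances of the hypersequent calculus `HE*` for the logic `EX`:
`HERule X ps H` says that `H` follows from the finitely many premisses `ps` by one application of
a rule. In the active component the antecedent consists of formulas `Γ` and blocks `Θ`. -/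
inductive HERule (X : Set ModalAxiom) : Multiset Hypersequent → Hypersequent → Prop where
  /- propositional rules -/
  | init (G : Hypersequent) (Γ : Multiset Formula) (Θ : Multiset Block) (Δ : Multiset Formula)
      (p : ℕ) :
      HERule X 0 (⟨atom p ::ₘ Γ, Θ, atom p ::ₘ Δ⟩ ::ₘ G)
  | botL (G : Hypersequent) (Γ : Multiset Formula) (Θ : Multiset Block) (Δ : Multiset Formula) :
      HERule X 0 (⟨bot ::ₘ Γ, Θ, Δ⟩ ::ₘ G)
  | topR (G : Hypersequent) (Γ : Multiset Formula) (Θ : Multiset Block) (Δ : Multiset Formula) :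
      HERule X 0 (⟨Γ, Θ, top ::ₘ Δ⟩ ::ₘ G)
  | andL (G : Hypersequent) (Γ : Multiset Formula) (Θ : Multiset Block) (Δ : Multiset Formula)
      (A B : Formula) :
      HERule X {⟨A ::ₘ B ::ₘ and A B ::ₘ Γ, Θ, Δ⟩ ::ₘ G} (⟨and A B ::ₘ Γ, Θ, Δ⟩ ::ₘ G)
  | andR (G : Hypersequent) (Γ : Multiset Formula) (Θ : Multiset Block) (Δ : Multiset Formula)
      (A B : Formula) :
      HERule X {⟨Γ, Θ, A ::ₘ and A B ::ₘ Δ⟩ ::ₘ G, ⟨Γ, Θ, B ::ₘ and A B ::ₘ Δ⟩ ::ₘ G}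
        (⟨Γ, Θ, and A B ::ₘ Δ⟩ ::ₘ G)
  | orL (G : Hypersequent) (Γ : Multiset Formula) (Θ : Multiset Block) (Δ : Multiset Formula)
      (A B : Formula) :
      HERule X {⟨A ::ₘ or A B ::ₘ Γ, Θ, Δ⟩ ::ₘ G, ⟨B ::ₘ or A B ::ₘ Γ, Θ, Δ⟩ ::ₘ G}
        (⟨or A B ::ₘ Γ, Θ, Δ⟩ ::ₘ G)
  | orR (G : Hypersequent) (Γ : Multiset Formula) (Θ : Multiset Block) (Δ : Multiset Formula)
      (A B : Formula) :
      HERule X {⟨Γ, Θ, A ::ₘ B ::ₘ or A B ::ₘ Δ⟩ ::ₘ G} (⟨Γ, Θ, or A B ::ₘ Δ⟩ ::ₘ G)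
  | impL (G : Hypersequent) (Γ : Multiset Formula) (Θ : Multiset Block) (Δ : Multiset Formula)
      (A B : Formula) :
      HERule X {⟨imp A B ::ₘ Γ, Θ, A ::ₘ Δ⟩ ::ₘ G, ⟨B ::ₘ imp A B ::ₘ Γ, Θ, Δ⟩ ::ₘ G}
        (⟨imp A B ::ₘ Γ, Θ, Δ⟩ ::ₘ G)
  | impR (G : Hypersequent) (Γ : Multiset Formula) (Θ : Multiset Block) (Δ : Multiset Formula)
      (A B : Formula) :
      HERule X {⟨A ::ₘ Γ, Θ, B ::ₘ imp A B ::ₘ Δ⟩ ::ₘ G} (⟨Γ, Θ, imp A B ::ₘ Δ⟩ ::ₘ G)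
  /- modal rules of the classical cube -/
  | boxL (G : Hypersequent) (Γ : Multiset Formula) (Θ : Multiset Block) (Δ : Multiset Formula)
      (A : Formula) :
      HERule X {⟨box A ::ₘ Γ, {A} ::ₘ Θ, Δ⟩ ::ₘ G} (⟨box A ::ₘ Γ, Θ, Δ⟩ ::ₘ G)
  | boxR (G : Hypersequent) (Γ : Multiset Formula) (Θ : Multiset Block) (Δ : Multiset Formula)
      (S : Block) (B : Formula) : ModalAxiom.M ∉ X →
      HERule X
        ((⟨S, 0, {B}⟩ ::ₘ ⟨Γ, S ::ₘ Θ, box B ::ₘ Δ⟩ ::ₘ G) ::ₘ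
          S.map (fun A => ⟨{B}, 0, {A}⟩ ::ₘ ⟨Γ, S ::ₘ Θ, box B ::ₘ Δ⟩ ::ₘ G))
        (⟨Γ, S ::ₘ Θ, box B ::ₘ Δ⟩ ::ₘ G)
  | boxRm (G : Hypersequent) (Γ : Multiset Formula) (Θ : Multiset Block) (Δ : Multiset Formula)
      (S : Block) (B : Formula) : ModalAxiom.M ∈ X →
      HERule X {⟨S, 0, {B}⟩ ::ₘ ⟨Γ, S ::ₘ Θ, box B ::ₘ Δ⟩ ::ₘ G}
        (⟨Γ, S ::ₘ Θ, box B ::ₘ Δ⟩ ::ₘ G)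
  | ruleN (G : Hypersequent) (Γ : Multiset Formula) (Θ : Multiset Block) (Δ : Multiset Formula) :
      ModalAxiom.N ∈ X →
      HERule X {⟨Γ, {top} ::ₘ Θ, Δ⟩ ::ₘ G} (⟨Γ, Θ, Δ⟩ ::ₘ G)
  | ruleC (G : Hypersequent) (Γ : Multiset Formula) (Θ : Multiset Block) (Δ : Multiset Formula)
      (S T : Block) : ModalAxiom.C ∈ X →
      HERule X {⟨Γ, (S + T) ::ₘ S ::ₘ T ::ₘ Θ, Δ⟩ ::ₘ G} (⟨Γ, S ::ₘ T ::ₘ Θ, Δ⟩ ::ₘ G)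
  /- modal rules of the extensions -/
  | ruleT (G : Hypersequent) (Γ : Multiset Formula) (Θ : Multiset Block) (Δ : Multiset Formula)
      (S : Block) : ModalAxiom.T ∈ X →
      HERule X {⟨S + Γ, S ::ₘ Θ, Δ⟩ ::ₘ G} (⟨Γ, S ::ₘ Θ, Δ⟩ ::ₘ G)
  /- the rule `P` also belongs to the monotonic calculi with `D` -/
  | ruleP (G : Hypersequent) (Γ : Multiset Formula) (Θ : Multiset Block) (Δ : Multiset Formula)
      (S : Block) : (ModalAxiom.P ∈ X ∨ (ModalAxiom.D ∈ X ∧ ModalAxiom.M ∈ X)) →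
      HERule X {⟨S, 0, 0⟩ ::ₘ ⟨Γ, S ::ₘ Θ, Δ⟩ ::ₘ G} (⟨Γ, S ::ₘ Θ, Δ⟩ ::ₘ G)
  | ruleD1 (G : Hypersequent) (Γ : Multiset Formula) (Θ : Multiset Block) (Δ : Multiset Formula)
      (S : Block) : ModalAxiom.D ∈ X → ModalAxiom.M ∉ X →
      HERule X
        ((⟨S, 0, 0⟩ ::ₘ ⟨Γ, S ::ₘ Θ, Δ⟩ ::ₘ G) ::ₘ
          S.map (fun A => ⟨0, 0, {A}⟩ ::ₘ ⟨Γ, S ::ₘ Θ, Δ⟩ ::ₘ G))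
        (⟨Γ, S ::ₘ Θ, Δ⟩ ::ₘ G)
  | ruleD2 (G : Hypersequent) (Γ : Multiset Formula) (Θ : Multiset Block) (Δ : Multiset Formula)
      (S T : Block) : ModalAxiom.D ∈ X → ModalAxiom.M ∉ X →
      HERule X
        ((⟨S + T, 0, 0⟩ ::ₘ ⟨Γ, S ::ₘ T ::ₘ Θ, Δ⟩ ::ₘ G) ::ₘ
          (S ×ˢ T).map (fun q => ⟨0, 0, {q.1, q.2}⟩ ::ₘ ⟨Γ, S ::ₘ T ::ₘ Θ, Δ⟩ ::ₘ G))
        (⟨Γ, S ::ₘ T ::ₘ Θ, Δ⟩ ::ₘ G)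
  | ruleDM (G : Hypersequent) (Γ : Multiset Formula) (Θ : Multiset Block) (Δ : Multiset Formula)
      (S T : Block) : ModalAxiom.D ∈ X → ModalAxiom.M ∈ X →
      HERule X {⟨S + T, 0, 0⟩ ::ₘ ⟨Γ, S ::ₘ T ::ₘ Θ, Δ⟩ ::ₘ G}
        (⟨Γ, S ::ₘ T ::ₘ Θ, Δ⟩ ::ₘ G)
  /- the calculus for `RDₙ⁺` has the rule for `m` blocks, for every `1 ≤ m ≤ n`;
  `L` is the multiset of the `m` active blocks and `L.sum` the union of their contents -/
  | ruleDplus (G : Hypersequent) (Γ : Multiset Formula) (Θ : Multiset Block)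
      (Δ : Multiset Formula) (n : ℕ+) (L : Multiset Block) :
      ModalAxiom.RD n ∈ X → 1 ≤ Multiset.card L → Multiset.card L ≤ (n : ℕ) →
      HERule X {⟨L.sum, 0, 0⟩ ::ₘ ⟨Γ, L + Θ, Δ⟩ ::ₘ G} (⟨Γ, L + Θ, Δ⟩ ::ₘ G)

/-- Instances of the cut rule: from `G | Γ ⇒ Δ, A` and `G | A, Γ ⇒ Δ` infer `G | Γ ⇒ Δ`. -/
inductive CutRule : Multiset Hypersequent → Hypersequent → Prop where
  | cut (G : Hypersequent) (Γ : Multiset Formula) (Θ : Multiset Block) (Δ : Multiset Formula)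
      (A : Formula) :
      CutRule {⟨Γ, Θ, A ::ₘ Δ⟩ ::ₘ G, ⟨A ::ₘ Γ, Θ, Δ⟩ ::ₘ G} (⟨Γ, Θ, Δ⟩ ::ₘ G)

/-- Hypersequents that have a (finite) derivation by means of the rule instances `R`. -/
inductive Derivable (R : Multiset Hypersequent → Hypersequent → Prop) : Hypersequent → Prop where
  | step (ps : Multiset Hypersequent) (H : Hypersequent) :
      R ps H → (∀ H' ∈ ps, Derivable R H') → Derivable R H

/-- The rule `r` is admissible in the calculus `R`: for each instance of `r`, if all premisses are
derivable in `R`, then so is the conclusion. -/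
def Admissible (R r : Multiset Hypersequent → Hypersequent → Prop) : Prop :=
  ∀ ps H, r ps H → (∀ H' ∈ ps, Derivable R H') → Derivable R H

/-- The calculus `HE*` for the logic `EX` extended with the cut rule. -/
def HECutRule (X : Set ModalAxiom) (ps : Multiset Hypersequent) (H : Hypersequent) : Prop :=
  HERule X ps H ∨ CutRule ps H

/-- The hypersequent whose only component is `⇒ A`. -/
def single (A : Formula) : Hypersequent := {⟨0, 0, {A}⟩}

end NNModal

/-! The argument is semantic. Read a block `⟨Σ⟩` as `□⋀Σ`, and call a hypersequent valid in a
neighbourhood model when one of its components holds at every world. In models satisfying the frame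
conditions of `X` all rules preserve validity, cut included (`Satisfies.hValid`), and theorems of
the Hilbert system hold at every world (`Satisfies.mem_sem`). Conversely, every hypersequent valid
in all these models is derivable without cut (`derivable_of_hValid`). The three claims follow by
composition.

For completeness, an underivable hypersequent is extended to a maximal set `𝓢` of sequents from
which no derivable hypersequent can be formed. Worlds are the maximal sets of items all of whose
finite parts lie in `𝓢`. Without cut a world may leave a formula undecided, so the truth lemma
consists of two implications: formulas on the left are true, formulas on the right are false. A
block is accordingly interpreted by an interval of neighbourhoods, and maximality turns each rule of
the calculus into a closure property of worlds or an existence property, which yields the truth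
lemma and the frame conditions.

Assembling finite derivations requires weakening and contraction (`Derivable.mono`), also for whole
blocks. When two active blocks are identified, a rule for two blocks must reduce to one for a single
block: `ruleD2` to `ruleD1`, `ruleDM` to `ruleP`, and `ruleDplus` to itself with fewer blocks. -/

namespace NNModal
open Formula

/-! ### Admissibility of weakening and contraction -/

/-- `s.Le t`: the components of `s` occur in `t`, disregarding multiplicities, also inside blocks. -/
structure Sequent.Le (s t : Sequent) : Prop where
  ant : s.ant ⊆ t.ant
  blk : ∀ S ∈ s.blk, ∃ T ∈ t.blk, ∀ A, A ∈ S ↔ A ∈ T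
  suc : s.suc ⊆ t.suc

theorem Sequent.Le.of_subset {s t : Sequent} (h₁ : s.ant ⊆ t.ant) (h₂ : s.blk ⊆ t.blk)
    (h₃ : s.suc ⊆ t.suc) : s.Le t :=
  ⟨h₁, fun S hS => ⟨S, h₂ hS, fun _ => Iff.rfl⟩, h₃⟩

theorem Sequent.Le.refl (s : Sequent) : s.Le s :=
  .of_subset (fun _ h => h) (fun _ h => h) (fun _ h => h)

theorem Sequent.Le.trans {s t u : Sequent} (h : s.Le t) (h' : t.Le u) : s.Le u := by
  refine ⟨fun _ hA => h'.ant (h.ant hA), fun S hS => ?_, fun _ hA => h'.suc (h.suc hA)⟩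
  obtain ⟨T, hT, hST⟩ := h.blk S hS
  obtain ⟨U, hU, hTU⟩ := h'.blk T hT
  exact ⟨U, hU, fun A => (hST A).trans (hTU A)⟩

/-- Every component of `G` is below some component of `H`. -/
def Hypersequent.Le (G H : Hypersequent) : Prop := ∀ s ∈ G, ∃ t ∈ H, s.Le t

theorem Hypersequent.Le.cons {G H : Hypersequent} {s t : Sequent} (hs : s.Le t)
    (hG : Hypersequent.Le G (t ::ₘ H)) : Hypersequent.Le (s ::ₘ G) (t ::ₘ H) := by
  intro u hu
  rcases Multiset.mem_cons.1 hu with rfl | hu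
  · exact ⟨t, Multiset.mem_cons_self _ _, hs⟩
  · exact hG u hu

theorem Hypersequent.Le.weaken {G H : Hypersequent} (hG : Hypersequent.Le G H) (s : Sequent) :
    Hypersequent.Le G (s ::ₘ H) := fun u hu =>
  let ⟨t, ht, h⟩ := hG u hu
  ⟨t, Multiset.mem_cons_of_mem ht, h⟩

/-- Under external contraction a side component may be matched with the active component itself. The
match survives when a rule, read upwards, enlarges the active component. -/
theorem Hypersequent.Le.replace {G H : Hypersequent} {s t : Sequent} (hs : s.Le t)
    (hG : Hypersequent.Le G (s ::ₘ H)) : Hypersequent.Le G (t ::ₘ H) := by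
  intro u hu
  obtain ⟨v, hv, huv⟩ := hG u hu
  rcases Multiset.mem_cons.1 hv with rfl | hv
  · exact ⟨t, Multiset.mem_cons_self _ _, huv.trans hs⟩
  · exact ⟨v, Multiset.mem_cons_of_mem hv, huv⟩

/-- Blocks with the same elements as blocks of `Θ` are covered by distinct occurrences in `Θ`. -/
theorem exists_le_cover (L Θ : Multiset Block)
    (h : ∀ S ∈ L, ∃ T ∈ Θ, ∀ A, A ∈ S ↔ A ∈ T) :
    ∃ L' ≤ Θ, Multiset.card L' ≤ Multiset.card L ∧ (1 ≤ Multiset.card L → 1 ≤ Multiset.card L') ∧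
      L.sum ⊆ L'.sum := by
  classical
  choose! f hf hfA using h
  -- Several blocks of `L` may have the same match, which may occur only once in `Θ`. Removing
  -- duplicates turns inclusion into `≤`.
  refine ⟨(L.map f).dedup, ?_, ?_, ?_, ?_⟩
  · rw [Multiset.le_iff_subset (Multiset.nodup_dedup _)]
    intro T hT
    obtain ⟨S, hS, rfl⟩ := Multiset.mem_map.1 (Multiset.mem_dedup.1 hT)
    exact hf S hS
  · simpa using Multiset.card_le_card (Multiset.dedup_le (L.map f))
  · intro hL
    obtain ⟨S, hS⟩ := Multiset.card_pos_iff_exists_mem.1 hL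
    exact Multiset.card_pos_iff_exists_mem.2
      ⟨f S, Multiset.mem_dedup.2 (Multiset.mem_map_of_mem f hS)⟩
  · intro A hA
    obtain ⟨S, hS, hA⟩ := Multiset.mem_join.1 hA
    exact Multiset.mem_join.2 ⟨f S, Multiset.mem_dedup.2 (Multiset.mem_map_of_mem f hS), (hfA S hS A).1 hA⟩

theorem exists_cons_cons_of_mem {α : Type*} {s : Multiset α} {a b : α} (ha : a ∈ s) (hb : b ∈ s)
    (hab : a ≠ b) : ∃ t, s = a ::ₘ b ::ₘ t := by
  obtain ⟨t, rfl⟩ := Multiset.exists_cons_of_mem ha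
  obtain ⟨u, rfl⟩ := Multiset.exists_cons_of_mem ((Multiset.mem_cons.1 hb).resolve_left hab.symm)
  exact ⟨u, rfl⟩

theorem cover_cons {Θ Θ' : Multiset Block} {S : Block}
    (h : ∀ T ∈ S ::ₘ Θ, ∃ T' ∈ Θ', ∀ A, A ∈ T ↔ A ∈ T') :
    ∃ S' ∈ Θ', ∀ A, A ∈ S ↔ A ∈ S' := h S (Multiset.mem_cons_self _ _)

/-- Weakening and contraction, internal and external, are admissible. -/
theorem Derivable.mono {X : Set ModalAxiom} {H H' : Hypersequent}
    (h : Derivable (HERule X) H) (hle : Hypersequent.Le H H') : Derivable (HERule X) H' := by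
  induction h generalizing H' with
  | step ps H r _ ih =>
  -- the active component is below a component of the target
  have key : ∀ {s : Sequent} {G : Hypersequent}, Hypersequent.Le (s ::ₘ G) H' →
      ∃ (Γ Δ : Multiset Formula) (Θ : Multiset Block) (G' : Hypersequent),
        H' = ⟨Γ, Θ, Δ⟩ ::ₘ G' ∧ s.Le ⟨Γ, Θ, Δ⟩ ∧ Hypersequent.Le G (⟨Γ, Θ, Δ⟩ ::ₘ G') := by
    intro s G hsG
    obtain ⟨⟨Γ, Θ, Δ⟩, hc, hsc⟩ := hsG s (Multiset.mem_cons_self _ _)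
    obtain ⟨G', rfl⟩ := Multiset.exists_cons_of_mem hc
    exact ⟨Γ, Δ, Θ, G', rfl, hsc, fun t ht => hsG t (Multiset.mem_cons_of_mem ht)⟩
  have memL : ∀ {A : Formula} {Γ Γ' : Multiset Formula}, A ::ₘ Γ ⊆ Γ' → ∃ Γ₀, Γ' = A ::ₘ Γ₀ :=
    fun h => Multiset.exists_cons_of_mem (h (Multiset.mem_cons_self _ _))
  cases r with
  | init G Γ Θ Δ p =>
    obtain ⟨Γ', Δ', Θ', G', rfl, hs, hG⟩ := key hle
    obtain ⟨Γ₀, rfl⟩ := memL hs.ant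
    obtain ⟨Δ₀, rfl⟩ := memL hs.suc
    exact .step _ _ (.init _ _ _ _ _) (by simp)
  | botL G Γ Θ Δ =>
    obtain ⟨Γ', Δ', Θ', G', rfl, hs, hG⟩ := key hle
    obtain ⟨Γ₀, rfl⟩ := memL hs.ant
    exact .step _ _ (.botL _ _ _ _) (by simp)
  | topR G Γ Θ Δ =>
    obtain ⟨Γ', Δ', Θ', G', rfl, hs, hG⟩ := key hle
    obtain ⟨Δ₀, rfl⟩ := memL hs.suc
    exact .step _ _ (.topR _ _ _ _) (by simp)
  | andL G Γ Θ Δ A B =>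
    obtain ⟨Γ', Δ', Θ', G', rfl, hs, hG⟩ := key hle
    obtain ⟨Γ₀, rfl⟩ := memL hs.ant
    refine .step _ _ (.andL _ _ _ _ A B) ?_
    simp only [Multiset.mem_singleton, forall_eq] at ih ⊢
    refine ih (.cons ⟨?_, hs.blk, hs.suc⟩ (hG.replace (.of_subset ?_ ?_ ?_)))
    · exact Multiset.cons_subset_cons (Multiset.cons_subset_cons hs.ant)
    all_goals intro; simp +contextual
  | andR G Γ Θ Δ A B =>
    obtain ⟨Γ', Δ', Θ', G', rfl, hs, hG⟩ := key hle
    obtain ⟨Δ₀, rfl⟩ := memL hs.suc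
    refine .step _ _ (.andR _ _ _ _ A B) ?_
    simp only [Multiset.insert_eq_cons, Multiset.mem_cons, Multiset.mem_singleton, forall_eq_or_imp,
      forall_eq] at ih ⊢
    constructor
    · refine ih.1 (.cons ⟨hs.ant, hs.blk, Multiset.cons_subset_cons hs.suc⟩
        (hG.replace (.of_subset ?_ ?_ ?_)))
      all_goals intro; simp +contextual
    · refine ih.2 (.cons ⟨hs.ant, hs.blk, Multiset.cons_subset_cons hs.suc⟩
        (hG.replace (.of_subset ?_ ?_ ?_)))
      all_goals intro; simp +contextual
  | orL G Γ Θ Δ A B =>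
    obtain ⟨Γ', Δ', Θ', G', rfl, hs, hG⟩ := key hle
    obtain ⟨Γ₀, rfl⟩ := memL hs.ant
    refine .step _ _ (.orL _ _ _ _ A B) ?_
    simp only [Multiset.insert_eq_cons, Multiset.mem_cons, Multiset.mem_singleton, forall_eq_or_imp,
      forall_eq] at ih ⊢
    constructor
    · refine ih.1 (.cons ⟨Multiset.cons_subset_cons hs.ant, hs.blk, hs.suc⟩
        (hG.replace (.of_subset ?_ ?_ ?_)))
      all_goals intro; simp +contextual
    · refine ih.2 (.cons ⟨Multiset.cons_subset_cons hs.ant, hs.blk, hs.suc⟩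
        (hG.replace (.of_subset ?_ ?_ ?_)))
      all_goals intro; simp +contextual
  | orR G Γ Θ Δ A B =>
    obtain ⟨Γ', Δ', Θ', G', rfl, hs, hG⟩ := key hle
    obtain ⟨Δ₀, rfl⟩ := memL hs.suc
    refine .step _ _ (.orR _ _ _ _ A B) ?_
    simp only [Multiset.mem_singleton, forall_eq] at ih ⊢
    refine ih (.cons ⟨hs.ant, hs.blk, ?_⟩ (hG.replace (.of_subset ?_ ?_ ?_)))
    · exact Multiset.cons_subset_cons (Multiset.cons_subset_cons hs.suc)
    all_goals intro; simp +contextual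
  | impL G Γ Θ Δ A B =>
    obtain ⟨Γ', Δ', Θ', G', rfl, hs, hG⟩ := key hle
    obtain ⟨Γ₀, rfl⟩ := memL hs.ant
    refine .step _ _ (.impL _ _ _ _ A B) ?_
    simp only [Multiset.insert_eq_cons, Multiset.mem_cons, Multiset.mem_singleton, forall_eq_or_imp,
      forall_eq] at ih ⊢
    constructor
    · refine ih.1 (.cons ⟨hs.ant, hs.blk, Multiset.cons_subset_cons hs.suc⟩
        (hG.replace (.of_subset ?_ ?_ ?_)))
      all_goals intro; simp +contextual
    · refine ih.2 (.cons ⟨Multiset.cons_subset_cons hs.ant, hs.blk, hs.suc⟩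
        (hG.replace (.of_subset ?_ ?_ ?_)))
      all_goals intro; simp +contextual
  | impR G Γ Θ Δ A B =>
    obtain ⟨Γ', Δ', Θ', G', rfl, hs, hG⟩ := key hle
    obtain ⟨Δ₀, rfl⟩ := memL hs.suc
    refine .step _ _ (.impR _ _ _ _ A B) ?_
    simp only [Multiset.mem_singleton, forall_eq] at ih ⊢
    refine ih (.cons ⟨Multiset.cons_subset_cons hs.ant, hs.blk, Multiset.cons_subset_cons hs.suc⟩
      (hG.replace (.of_subset ?_ ?_ ?_)))
    all_goals intro; simp +contextual
  | boxL G Γ Θ Δ A =>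
    obtain ⟨Γ', Δ', Θ', G', rfl, hs, hG⟩ := key hle
    obtain ⟨Γ₀, rfl⟩ := memL hs.ant
    refine .step _ _ (.boxL _ _ _ _ A) ?_
    simp only [Multiset.mem_singleton, forall_eq] at ih ⊢
    refine ih (.cons ⟨hs.ant, ?_, hs.suc⟩ (hG.replace (.of_subset ?_ ?_ ?_)))
    · intro S hS
      rcases Multiset.mem_cons.1 hS with rfl | hS
      · exact ⟨_, Multiset.mem_cons_self _ _, fun _ => Iff.rfl⟩
      · obtain ⟨T, hT, h⟩ := hs.blk S hS
        exact ⟨T, Multiset.mem_cons_of_mem hT, h⟩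
    all_goals intro; simp +contextual
  | boxR G Γ Θ Δ S B hM =>
    obtain ⟨Γ', Δ', Θ', G', rfl, hs, hG⟩ := key hle
    obtain ⟨S', hS', hSS⟩ := cover_cons hs.blk
    obtain ⟨Θ₀, rfl⟩ := Multiset.exists_cons_of_mem hS'
    obtain ⟨Δ₀, rfl⟩ := memL hs.suc
    refine .step _ _ (.boxR _ _ _ _ S' B hM) ?_
    simp only [Multiset.mem_cons, Multiset.mem_map, forall_eq_or_imp, forall_exists_index, and_imp,
      forall_apply_eq_imp_iff₂] at ih ⊢
    constructor
    · exact ih.1 (.cons ⟨fun A hA => (hSS A).1 hA, by simp, fun _ h => h⟩ ((Hypersequent.Le.cons hs hG).weaken _))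
    · exact fun A hA => ih.2 A ((hSS A).2 hA) (.cons (.refl _) ((Hypersequent.Le.cons hs hG).weaken _))
  | boxRm G Γ Θ Δ S B hM =>
    obtain ⟨Γ', Δ', Θ', G', rfl, hs, hG⟩ := key hle
    obtain ⟨S', hS', hSS⟩ := cover_cons hs.blk
    obtain ⟨Θ₀, rfl⟩ := Multiset.exists_cons_of_mem hS'
    obtain ⟨Δ₀, rfl⟩ := memL hs.suc
    refine .step _ _ (.boxRm _ _ _ _ S' B hM) ?_
    simp only [Multiset.mem_singleton, forall_eq] at ih ⊢
    exact ih (.cons ⟨fun A hA => (hSS A).1 hA, by simp, fun _ h => h⟩ ((Hypersequent.Le.cons hs hG).weaken _))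
  | ruleN G Γ Θ Δ hN =>
    obtain ⟨Γ', Δ', Θ', G', rfl, hs, hG⟩ := key hle
    refine .step _ _ (.ruleN _ _ _ _ hN) ?_
    simp only [Multiset.mem_singleton, forall_eq] at ih ⊢
    refine ih (.cons ⟨hs.ant, ?_, hs.suc⟩ (hG.replace (.of_subset ?_ ?_ ?_)))
    · intro S hS
      rcases Multiset.mem_cons.1 hS with rfl | hS
      · exact ⟨_, Multiset.mem_cons_self _ _, fun _ => Iff.rfl⟩
      · obtain ⟨T, hT, h⟩ := hs.blk S hS
        exact ⟨T, Multiset.mem_cons_of_mem hT, h⟩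
    all_goals intro; simp +contextual
  | ruleC G Γ Θ Δ S T hC =>
    obtain ⟨Γ', Δ', Θ', G', rfl, hs, hG⟩ := key hle
    obtain ⟨S', hS', hSS⟩ := cover_cons hs.blk
    obtain ⟨T', hT', hTT⟩ := cover_cons fun U hU => hs.blk U (Multiset.mem_cons_of_mem hU)
    simp only [Multiset.mem_singleton, forall_eq] at ih
    by_cases hST : S' = T'
    -- If both active blocks match the same block, so does their sum, because blocks are compared by
    -- their elements only. No application of `ruleC` is needed.
    · subst hST
      refine ih (.cons ⟨hs.ant, ?_, hs.suc⟩ hG)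
      intro U hU
      rcases Multiset.mem_cons.1 hU with rfl | hU
      · exact ⟨S', hS', fun A => by simp [hSS, hTT]⟩
      · exact hs.blk U hU
    · obtain ⟨Θ₀, rfl⟩ := exists_cons_cons_of_mem hS' hT' hST
      refine .step _ _ (.ruleC _ _ _ _ S' T' hC) ?_
      simp only [Multiset.mem_singleton, forall_eq]
      refine ih (.cons ⟨hs.ant, ?_, hs.suc⟩ (hG.replace (.of_subset ?_ ?_ ?_)))
      · intro U hU
        rcases Multiset.mem_cons.1 hU with rfl | hU
        · exact ⟨_, Multiset.mem_cons_self _ _, fun A => by simp [hSS, hTT]⟩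
        · obtain ⟨V, hV, h⟩ := hs.blk U hU
          exact ⟨V, Multiset.mem_cons_of_mem hV, h⟩
      all_goals intro; simp +contextual
  | ruleT G Γ Θ Δ S hT =>
    obtain ⟨Γ', Δ', Θ', G', rfl, hs, hG⟩ := key hle
    obtain ⟨S', hS', hSS⟩ := cover_cons hs.blk
    obtain ⟨Θ₀, rfl⟩ := Multiset.exists_cons_of_mem hS'
    refine .step _ _ (.ruleT _ _ _ _ S' hT) ?_
    simp only [Multiset.mem_singleton, forall_eq] at ih ⊢
    refine ih (.cons ⟨?_, hs.blk, hs.suc⟩ (hG.replace (.of_subset ?_ ?_ ?_)))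
    · intro A hA
      rcases Multiset.mem_add.1 hA with hA | hA
      · exact Multiset.mem_add.2 (.inl ((hSS A).1 hA))
      · exact Multiset.mem_add.2 (.inr (hs.ant hA))
    all_goals intro; simp +contextual
  | ruleP G Γ Θ Δ S hP =>
    obtain ⟨Γ', Δ', Θ', G', rfl, hs, hG⟩ := key hle
    obtain ⟨S', hS', hSS⟩ := cover_cons hs.blk
    obtain ⟨Θ₀, rfl⟩ := Multiset.exists_cons_of_mem hS'
    refine .step _ _ (.ruleP _ _ _ _ S' hP) ?_
    simp only [Multiset.mem_singleton, forall_eq] at ih ⊢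
    exact ih (.cons ⟨fun A hA => (hSS A).1 hA, by simp, fun _ h => h⟩ ((Hypersequent.Le.cons hs hG).weaken _))
  | ruleD1 G Γ Θ Δ S hD hM =>
    obtain ⟨Γ', Δ', Θ', G', rfl, hs, hG⟩ := key hle
    obtain ⟨S', hS', hSS⟩ := cover_cons hs.blk
    obtain ⟨Θ₀, rfl⟩ := Multiset.exists_cons_of_mem hS'
    refine .step _ _ (.ruleD1 _ _ _ _ S' hD hM) ?_
    simp only [Multiset.mem_cons, Multiset.mem_map, forall_eq_or_imp, forall_exists_index, and_imp,
      forall_apply_eq_imp_iff₂] at ih ⊢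
    constructor
    · exact ih.1 (.cons ⟨fun A hA => (hSS A).1 hA, by simp, fun _ h => h⟩ ((Hypersequent.Le.cons hs hG).weaken _))
    · exact fun A hA => ih.2 A ((hSS A).2 hA) (.cons (.refl _) ((Hypersequent.Le.cons hs hG).weaken _))
  | ruleD2 G Γ Θ Δ S T hD hM =>
    obtain ⟨Γ', Δ', Θ', G', rfl, hs, hG⟩ := key hle
    obtain ⟨S', hS', hSS⟩ := cover_cons hs.blk
    obtain ⟨T', hT', hTT⟩ := cover_cons fun U hU => hs.blk U (Multiset.mem_cons_of_mem hU)
    simp only [Multiset.mem_cons, Multiset.mem_map, Multiset.mem_product, forall_eq_or_imp,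
      forall_exists_index, and_imp, Prod.forall] at ih
    -- When the two blocks are contracted to one, `ruleD1` takes over: its premiss `⇒ A` comes from
    -- the premiss `⇒ A, A` of `ruleD2`.
    by_cases hST : S' = T'
    · subst hST
      obtain ⟨Θ₀, rfl⟩ := Multiset.exists_cons_of_mem hS'
      refine .step _ _ (.ruleD1 _ _ _ _ S' hD hM) ?_
      simp only [Multiset.mem_cons, Multiset.mem_map, forall_eq_or_imp, forall_exists_index,
        and_imp, forall_apply_eq_imp_iff₂]
      constructor
      · refine ih.1 (.cons ⟨fun A hA => ?_, by simp, fun _ h => h⟩ ((Hypersequent.Le.cons hs hG).weaken _))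
        simpa [hSS, hTT] using hA
      · refine fun A hA => ih.2 _ A A ((hSS A).2 hA) ((hTT A).2 hA) rfl
          (.cons (.of_subset ?_ ?_ ?_) ((Hypersequent.Le.cons hs hG).weaken _))
        all_goals intro; simp +contextual
    · obtain ⟨Θ₀, rfl⟩ := exists_cons_cons_of_mem hS' hT' hST
      refine .step _ _ (.ruleD2 _ _ _ _ S' T' hD hM) ?_
      simp only [Multiset.mem_cons, Multiset.mem_map, Multiset.mem_product, forall_eq_or_imp,
        forall_exists_index, and_imp, Prod.forall]
      constructor
      · refine ih.1 (.cons ⟨fun A hA => ?_, by simp, fun _ h => h⟩ ((Hypersequent.Le.cons hs hG).weaken _))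
        simpa [hSS, hTT] using hA
      · rintro _ A B hA hB rfl
        exact ih.2 _ A B ((hSS A).2 hA) ((hTT B).2 hB) rfl
          (.cons (.refl _) ((Hypersequent.Le.cons hs hG).weaken _))
  | ruleDM G Γ Θ Δ S T hD hM =>
    obtain ⟨Γ', Δ', Θ', G', rfl, hs, hG⟩ := key hle
    obtain ⟨S', hS', hSS⟩ := cover_cons hs.blk
    obtain ⟨T', hT', hTT⟩ := cover_cons fun U hU => hs.blk U (Multiset.mem_cons_of_mem hU)
    simp only [Multiset.mem_singleton, forall_eq] at ih
    -- Contracting the two blocks turns the inference into `ruleP`, available in the presence of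
    -- both `D` and `M`.
    by_cases hST : S' = T'
    · subst hST
      obtain ⟨Θ₀, rfl⟩ := Multiset.exists_cons_of_mem hS'
      refine .step _ _ (.ruleP _ _ _ _ S' (.inr ⟨hD, hM⟩)) ?_
      simp only [Multiset.mem_singleton, forall_eq]
      refine ih (.cons ⟨fun A hA => ?_, by simp, fun _ h => h⟩ ((Hypersequent.Le.cons hs hG).weaken _))
      simpa [hSS, hTT] using hA
    · obtain ⟨Θ₀, rfl⟩ := exists_cons_cons_of_mem hS' hT' hST
      refine .step _ _ (.ruleDM _ _ _ _ S' T' hD hM) ?_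
      simp only [Multiset.mem_singleton, forall_eq]
      refine ih (.cons ⟨fun A hA => ?_, by simp, fun _ h => h⟩ ((Hypersequent.Le.cons hs hG).weaken _))
      simpa [hSS, hTT] using hA
  | ruleDplus G Γ Θ Δ n L hn h1 hc =>
    obtain ⟨Γ', Δ', Θ', G', rfl, hs, hG⟩ := key hle
    -- Contraction may lower the number of active blocks, but not to zero; the rule is available for
    -- every such number.
    obtain ⟨L', hL', hcard, hpos, hsum⟩ := exists_le_cover L Θ'
      fun S hS => hs.blk S (Multiset.mem_add.2 (.inl hS))
    obtain ⟨Θ₀, rfl⟩ := Multiset.le_iff_exists_add.1 hL'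
    refine .step _ _ (.ruleDplus _ _ _ _ n L' hn (hpos h1) (hcard.trans hc)) ?_
    simp only [Multiset.mem_singleton, forall_eq] at ih ⊢
    exact ih (.cons ⟨hsum, by simp, fun _ h => h⟩ ((Hypersequent.Le.cons hs hG).weaken _))


/-! ### Neighbourhood semantics -/

/-- Neighbourhood models. -/
structure NModel where
  World : Type
  nbhd : World → Set (Set World)
  val : ℕ → Set World

namespace NModel

variable (M : NModel)

/-- The truth set of a formula. -/
def sem : Formula → Set M.World
  | .atom p => M.val p
  | .bot => ∅
  | .top => Set.univ
  | .and A B => {w | w ∈ sem A ∧ w ∈ sem B}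
  | .or A B => {w | w ∈ sem A ∨ w ∈ sem B}
  | .imp A B => {w | w ∈ sem A → w ∈ sem B}
  | .box A => {w | sem A ∈ M.nbhd w}

/-- The truth set of the conjunction of a block. -/
def semBlock (S : Block) : Set M.World := {w | ∀ A ∈ S, w ∈ M.sem A}

/-- A sequent is valid if it holds at all worlds, a block `⟨Σ⟩` being read as `□⋀Σ`. -/
def Valid (s : Sequent) : Prop :=
  ∀ w, (∀ A ∈ s.ant, w ∈ M.sem A) → (∀ S ∈ s.blk, M.semBlock S ∈ M.nbhd w) →
    ∃ A ∈ s.suc, w ∈ M.sem A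

/-- A hypersequent is valid in a model if one of its components is. -/
def HValid (H : Hypersequent) : Prop := ∃ s ∈ H, M.Valid s

/-- The model satisfies the frame conditions that correspond to the axioms in `X`. -/
structure Satisfies (X : Set ModalAxiom) : Prop where
  condM : ModalAxiom.M ∈ X → ∀ w U V, U ∈ M.nbhd w → U ⊆ V → V ∈ M.nbhd w
  condC : ModalAxiom.C ∈ X → ∀ w U V, U ∈ M.nbhd w → V ∈ M.nbhd w → U ∩ V ∈ M.nbhd w
  condN : ModalAxiom.N ∈ X → ∀ w, Set.univ ∈ M.nbhd w
  condT : ModalAxiom.T ∈ X → ∀ w, ∀ U ∈ M.nbhd w, w ∈ U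
  condP : ModalAxiom.P ∈ X → ∀ w, ∅ ∉ M.nbhd w
  condD : ModalAxiom.D ∈ X → ∀ w, ∀ U ∈ M.nbhd w, Uᶜ ∉ M.nbhd w
  condRD : ∀ n : ℕ+, ModalAxiom.RD n ∈ X → ∀ w (L : Multiset (Set M.World)),
    1 ≤ Multiset.card L → Multiset.card L ≤ (n : ℕ) → (∀ U ∈ L, U ∈ M.nbhd w) →
      ∃ v, ∀ U ∈ L, v ∈ U

variable {M}

theorem hValid_cons {s : Sequent} {G : Hypersequent} :
    M.HValid (s ::ₘ G) ↔ M.Valid s ∨ M.HValid G := by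
  simp [HValid]

theorem semBlock_singleton (A : Formula) : M.semBlock {A} = M.sem A := by
  ext w; simp [semBlock]

theorem semBlock_add (S T : Block) : M.semBlock (S + T) = M.semBlock S ∩ M.semBlock T := by
  ext w; simp [semBlock, or_imp, forall_and]

/-- Under `D` and `M`, an empty neighbourhood would by monotonicity bring its complement along,
against `D`. -/
theorem Satisfies.empty_notMem {X : Set ModalAxiom} (hM : M.Satisfies X)
    (h : ModalAxiom.P ∈ X ∨ (ModalAxiom.D ∈ X ∧ ModalAxiom.M ∈ X)) (w : M.World) :
    ∅ ∉ M.nbhd w := by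
  rcases h with h | ⟨hD, hM'⟩
  · exact hM.condP h w
  · intro h
    exact hM.condD hD w _ h (hM.condM hM' w _ _ h (Set.empty_subset _))

theorem Satisfies.inter_nonempty {X : Set ModalAxiom} (hM : M.Satisfies X)
    (hD : ModalAxiom.D ∈ X) (hM' : ModalAxiom.M ∈ X) {w : M.World} {U V : Set M.World}
    (hU : U ∈ M.nbhd w) (hV : V ∈ M.nbhd w) : (U ∩ V).Nonempty := by
  rw [← Set.not_disjoint_iff_nonempty_inter]
  intro h
  exact hM.condD hD w U hU (hM.condM hM' w V _ hV h.subset_compl_left)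

/-! ### Soundness of the calculus with cut and of the Hilbert system -/

/-- Soundness of the rules of the calculus. -/
theorem Satisfies.hValid_of_rule {X : Set ModalAxiom} (hM : M.Satisfies X)
    {ps : Multiset Hypersequent} {H : Hypersequent} (r : HERule X ps H)
    (h : ∀ H' ∈ ps, M.HValid H') : M.HValid H := by
  cases r with
  | init G Γ Θ Δ p => exact hValid_cons.2 (.inl fun w h _ => ⟨atom p, by simp, h _ (by simp)⟩)
  | botL G Γ Θ Δ => exact hValid_cons.2 (.inl fun w h _ => (h bot (by simp)).elim)
  | topR G Γ Θ Δ => exact hValid_cons.2 (.inl fun w _ _ => ⟨top, by simp, trivial⟩)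
  | andL G Γ Θ Δ A B =>
    simp only [Multiset.mem_singleton, forall_eq, hValid_cons] at h ⊢
    refine h.imp_left fun h w ha hb => h w ?_ hb
    have := ha (and A B) (by simp)
    simpa using ⟨this.1, this.2, by simpa using ha⟩
  | andR G Γ Θ Δ A B =>
    simp only [Multiset.insert_eq_cons, Multiset.mem_cons, Multiset.mem_singleton, forall_eq_or_imp,
      forall_eq, hValid_cons] at h ⊢
    obtain ⟨h₁ | h, h₂ | h⟩ := h
    case inl.inl =>
      refine .inl fun w ha hb => ?_
      have h₁ := h₁ w ha hb
      have h₂ := h₂ w ha hb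
      simp only [Multiset.mem_cons, exists_eq_or_imp] at h₁ h₂ ⊢
      have h₃ : w ∈ M.sem A → w ∈ M.sem B → w ∈ M.sem (and A B) := fun a b => ⟨a, b⟩
      tauto
    all_goals exact .inr h
  | orL G Γ Θ Δ A B =>
    simp only [Multiset.insert_eq_cons, Multiset.mem_cons, Multiset.mem_singleton, forall_eq_or_imp,
      forall_eq, hValid_cons] at h ⊢
    obtain ⟨h₁ | h, h₂ | h⟩ := h
    case inl.inl =>
      refine .inl fun w ha hb => ?_
      rcases ha (or A B) (by simp) with h | h
      · exact h₁ w (by simpa [h] using ha) hb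
      · exact h₂ w (by simpa [h] using ha) hb
    all_goals exact .inr h
  | orR G Γ Θ Δ A B =>
    simp only [Multiset.mem_singleton, forall_eq, hValid_cons] at h ⊢
    refine h.imp_left fun h w ha hb => ?_
    have h := h w ha hb
    simp only [Multiset.mem_cons, exists_eq_or_imp] at h ⊢
    have h₁ : w ∈ M.sem A → w ∈ M.sem (or A B) := .inl
    have h₂ : w ∈ M.sem B → w ∈ M.sem (or A B) := .inr
    tauto
  | impL G Γ Θ Δ A B =>
    simp only [Multiset.insert_eq_cons, Multiset.mem_cons, Multiset.mem_singleton, forall_eq_or_imp,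
      forall_eq, hValid_cons] at h ⊢
    obtain ⟨h₁ | h, h₂ | h⟩ := h
    case inl.inl =>
      refine .inl fun w ha hb => ?_
      have h₁ := h₁ w ha hb
      simp only [Multiset.mem_cons, exists_eq_or_imp] at h₁
      rcases h₁ with h | h
      · exact h₂ w (by simpa [ha (imp A B) (by simp) h] using ha) hb
      · exact h
    all_goals exact .inr h
  | impR G Γ Θ Δ A B =>
    simp only [Multiset.mem_singleton, forall_eq, hValid_cons] at h ⊢
    refine h.imp_left fun h w ha hb => ?_
    simp only [Multiset.mem_cons, exists_eq_or_imp]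
    by_cases hA : w ∈ M.sem A
    · have h := h w (by simpa [hA] using ha) hb
      simp only [Multiset.mem_cons, exists_eq_or_imp] at h
      have h₂ : w ∈ M.sem B → w ∈ M.sem (imp A B) := fun h _ => h
      tauto
    · exact .inl fun h => (hA h).elim
  | boxL G Γ Θ Δ A =>
    simp only [Multiset.mem_singleton, forall_eq, hValid_cons] at h ⊢
    refine h.imp_left fun h w ha hb => h w ha ?_
    have : M.semBlock {A} ∈ M.nbhd w := by
      rw [semBlock_singleton]; exact ha (box A) (by simp)
    simpa [this] using hb
  | boxR G Γ Θ Δ S B hM' =>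
    simp only [Multiset.mem_cons, Multiset.mem_map, forall_eq_or_imp, forall_exists_index, and_imp,
      forall_apply_eq_imp_iff₂, hValid_cons] at h ⊢
    -- Every premiss contains the conclusion. If the latter is not valid, each premiss must be valid
    -- through its new component.
    by_contra hcon
    obtain ⟨h₁, h₂⟩ := h
    replace h₁ := h₁.resolve_right hcon
    replace h₂ := fun A hA => (h₂ A hA).resolve_right hcon
    refine hcon (.inl fun w ha hb => ⟨box B, by simp, ?_⟩)
    -- The components `B ⇒ A` give one inclusion, `S ⇒ B` the other.
    have : M.sem B = M.semBlock S := by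
      ext v
      constructor
      · intro hv A hA
        simpa using h₂ A hA v (by simpa using hv) (by simp)
      · intro hv
        simpa using h₁ v hv (by simp)
    change M.sem B ∈ M.nbhd w
    rw [this]
    exact hb S (by simp)
  | boxRm G Γ Θ Δ S B hM' =>
    simp only [Multiset.mem_singleton, forall_eq, hValid_cons] at h ⊢
    rcases h with h | h
    · exact .inl fun w ha hb => ⟨box B, by simp,
        hM.condM hM' w _ _ (hb S (by simp)) fun v hv => by simpa using h v hv (by simp)⟩
    · exact h
  | ruleN G Γ Θ Δ hN =>
    simp only [Multiset.mem_singleton, forall_eq, hValid_cons] at h ⊢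
    refine h.imp_left fun h w ha hb => h w ha ?_
    have : M.semBlock {top} ∈ M.nbhd w := by
      rw [semBlock_singleton]; exact hM.condN hN w
    simpa [this] using hb
  | ruleC G Γ Θ Δ S T hC =>
    simp only [Multiset.mem_singleton, forall_eq, hValid_cons] at h ⊢
    refine h.imp_left fun h w ha hb => h w ha ?_
    have : M.semBlock (S + T) ∈ M.nbhd w := by
      rw [semBlock_add]; exact hM.condC hC w _ _ (hb S (by simp)) (hb T (by simp))
    simpa [this] using hb
  | ruleT G Γ Θ Δ S hT =>
    simp only [Multiset.mem_singleton, forall_eq, hValid_cons] at h ⊢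
    refine h.imp_left fun h w ha hb => h w ?_ hb
    have : w ∈ M.semBlock S := hM.condT hT w _ (hb S (by simp))
    intro A hA
    rcases Multiset.mem_add.1 hA with hA | hA
    · exact this A hA
    · exact ha A hA
  | ruleP G Γ Θ Δ S hP =>
    simp only [Multiset.mem_singleton, forall_eq, hValid_cons] at h ⊢
    rcases h with h | h
    · refine .inl fun w ha hb => (hM.empty_notMem hP w ?_).elim
      have : M.semBlock S = ∅ := by
        ext v
        simpa using fun hv : v ∈ M.semBlock S => h v hv (by simp)
      rw [← this]
      exact hb S (by simp)
    · exact h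
  | ruleD1 G Γ Θ Δ S hD hM' =>
    simp only [Multiset.mem_cons, Multiset.mem_map, forall_eq_or_imp, forall_exists_index, and_imp,
      forall_apply_eq_imp_iff₂, hValid_cons] at h ⊢
    by_contra hcon
    obtain ⟨h₁, h₂⟩ := h
    replace h₁ := h₁.resolve_right hcon
    replace h₂ := fun A hA => (h₂ A hA).resolve_right hcon
    refine hcon (.inl fun w ha hb => ?_)
    simpa using h₁ w (fun A hA => by simpa using h₂ A hA w (by simp) (by simp)) (by simp)
  | ruleD2 G Γ Θ Δ S T hD hM' =>
    simp only [Multiset.mem_cons, Multiset.mem_map, Multiset.mem_product, forall_eq_or_imp,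
      forall_exists_index, and_imp, Prod.forall, hValid_cons] at h ⊢
    by_contra hcon
    obtain ⟨h₁, h₂⟩ := h
    replace h₁ := h₁.resolve_right hcon
    replace h₂ := fun A B hA hB =>
      (hValid_cons.1 (h₂ _ A B hA hB rfl)).resolve_right fun h => hcon (hValid_cons.1 h)
    refine hcon (.inl fun w ha hb => ?_)
    refine (hM.condD hD w _ (hb S (by simp)) ?_).elim
    -- The components `⇒ A, B` make the two truth sets cover all worlds; `S, T ⇒` makes them
    -- disjoint.
    have : (M.semBlock S)ᶜ = M.semBlock T := by
      ext v
      constructor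
      · intro hv B hB
        by_contra hvB
        refine hv fun A hA => ?_
        have := h₂ A B hA hB v (by simp) (by simp)
        simpa [hvB] using this
      · intro hvT hvS
        have hv : v ∈ M.semBlock (S + T) := by
          rw [semBlock_add]; exact ⟨hvS, hvT⟩
        simpa using h₁ v hv (by simp)
    rw [this]
    exact hb T (by simp)
  | ruleDM G Γ Θ Δ S T hD hM' =>
    simp only [Multiset.mem_singleton, forall_eq, hValid_cons] at h ⊢
    rcases h with h | h
    · refine .inl fun w ha hb => ?_
      obtain ⟨v, hv⟩ := hM.inter_nonempty hD hM' (hb S (by simp)) (hb T (by simp))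
      rw [← semBlock_add] at hv
      simpa using h v hv (by simp)
    · exact h
  | ruleDplus G Γ Θ Δ n L hn h1 hc =>
    simp only [Multiset.mem_singleton, forall_eq, hValid_cons] at h ⊢
    rcases h with h | h
    · refine .inl fun w ha hb => ?_
      obtain ⟨v, hv⟩ := hM.condRD n hn w (L.map M.semBlock) (by simpa using h1) (by simpa using hc)
        (by simpa using fun S hS => hb S (Multiset.mem_add.2 (.inl hS)))
      have : ∀ A ∈ L.sum, v ∈ M.sem A := by
        intro A hA
        obtain ⟨S, hS, hA⟩ := Multiset.mem_join.1 hA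
        exact hv _ (Multiset.mem_map_of_mem _ hS) A hA
      simpa using h v this (by simp)
    · exact h

theorem hValid_of_cut {ps : Multiset Hypersequent} {H : Hypersequent} (r : CutRule ps H)
    (h : ∀ H' ∈ ps, M.HValid H') : M.HValid H := by
  obtain ⟨G, Γ, Θ, Δ, A⟩ := r
  simp only [Multiset.insert_eq_cons, Multiset.mem_cons, Multiset.mem_singleton, forall_eq_or_imp,
    forall_eq, hValid_cons] at h ⊢
  obtain ⟨h₁ | h, h₂ | h⟩ := h
  case inl.inl =>
    refine .inl fun w ha hb => ?_
    have h₁ := h₁ w ha hb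
    simp only [Multiset.mem_cons, exists_eq_or_imp] at h₁
    rcases h₁ with h | h
    · exact h₂ w (by simpa [h] using ha) hb
    · exact h
  all_goals exact .inr h

/-- Soundness of the calculus with cut. -/
theorem Satisfies.hValid {X : Set ModalAxiom} (hM : M.Satisfies X) {H : Hypersequent}
    (h : Derivable (HECutRule X) H) : M.HValid H := by
  induction h with
  | step ps H r _ ih => exact r.elim (fun r => hM.hValid_of_rule r ih) fun r => hValid_of_cut r ih

/-- Each world induces a propositional valuation in which boxed formulas count as atoms, so
tautologies hold at every world. -/
theorem truth_iff (w : M.World) (A : Formula) :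
    truth (fun p => w ∈ M.val p) (fun A => w ∈ M.sem (box A)) A ↔ w ∈ M.sem A := by
  induction A with
  | atom p => rfl
  | bot => rfl
  | top => exact iff_of_true trivial trivial
  | and A B hA hB => exact and_congr hA hB
  | or A B hA hB => exact or_congr hA hB
  | imp A B hA hB => exact imp_congr hA hB
  | box A => rfl

theorem mem_sem_conj (w : M.World) (l : List Formula) :
    w ∈ M.sem (conj l) ↔ ∀ A ∈ l, w ∈ M.sem A := by
  induction l with
  | nil => simp [conj, sem]
  | cons A l ih =>
    cases l with
    | nil => simp [conj]
    | cons B l =>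
      rw [List.forall_mem_cons, ← ih]
      rfl

/-- Soundness of the Hilbert system. -/
theorem Satisfies.mem_sem {X : Set ModalAxiom} (hM : M.Satisfies X) {A : Formula}
    (h : Provable X A) (w : M.World) : w ∈ M.sem A := by
  induction h generalizing w with
  | taut A h => exact (truth_iff w A).1 (h _ _)
  | mp A B _ _ h₁ h₂ => exact h₁ w (h₂ w)
  | re A B _ h =>
    have : M.sem A = M.sem B := by
      ext v
      exact ⟨(h v).1, (h v).2⟩
    exact ⟨fun h => (this ▸ h : M.sem B ∈ M.nbhd w), fun h => (this ▸ h : M.sem A ∈ M.nbhd w)⟩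
  | axM A B hX => exact fun h => hM.condM hX w _ _ h fun v hv => hv.1
  | axC A B hX => exact fun h => hM.condC hX w _ _ h.1 h.2
  | axN hX => exact hM.condN hX w
  | axT A hX => exact fun h => hM.condT hX w _ h
  | axP hX => exact fun h => hM.condP hX w h
  | axD A hX =>
    intro h
    refine hM.condD hX w _ h.1 ?_
    have : (M.sem A)ᶜ = M.sem (neg A) := rfl
    rw [this]
    exact h.2
  | rd n l hX hl _ ih =>
    intro h
    rw [mem_sem_conj] at h
    obtain ⟨v, hv⟩ := hM.condRD n hX w (l.map M.sem : Multiset (Set M.World))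
      (by rw [Multiset.coe_card, List.length_map, hl]; exact n.pos) (by simp [hl]) (by
        simp only [Multiset.mem_coe, List.mem_map, forall_exists_index, and_imp,
          forall_apply_eq_imp_iff₂]
        exact fun A hA => h (box A) (List.mem_map_of_mem hA))
    exact ih v ((mem_sem_conj v l).2 fun A hA => hv _ (by simpa using ⟨A, hA, rfl⟩))

end NModel

/-! ### Sequents as finite sets of items -/

/-- A formula in the antecedent, a block, or a formula in the succedent of a component. -/
inductive Item : Type where
  | left : Formula → Item
  | block : Block → Item
  | right : Formula → Item

open Item

namespace Sequent

/-- The set of items of a sequent. -/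
def items (s : Sequent) : Set Item :=
  left '' {A | A ∈ s.ant} ∪ block '' {S | S ∈ s.blk} ∪ right '' {A | A ∈ s.suc}

theorem left_mem_items {s : Sequent} {A : Formula} : left A ∈ s.items ↔ A ∈ s.ant := by
  simp [items]

theorem block_mem_items {s : Sequent} {S : Block} : block S ∈ s.items ↔ S ∈ s.blk := by
  simp [items]

theorem right_mem_items {s : Sequent} {A : Formula} : right A ∈ s.items ↔ A ∈ s.suc := by
  simp [items]

theorem items_finite (s : Sequent) : s.items.Finite :=
  ((s.ant.finite_toSet.image _).union (s.blk.finite_toSet.image _)).union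
    (s.suc.finite_toSet.image _)

theorem items_subset {s : Sequent} {w : Set Item} : s.items ⊆ w ↔
    (∀ A ∈ s.ant, left A ∈ w) ∧ (∀ S ∈ s.blk, block S ∈ w) ∧ ∀ A ∈ s.suc, right A ∈ w := by
  simp only [items, Set.union_subset_iff, Set.image_subset_iff, and_assoc]
  rfl

theorem Le.of_items {s t : Sequent} (h : s.items ⊆ t.items) : s.Le t := by
  simp only [items_subset, left_mem_items, block_mem_items, right_mem_items] at h
  exact .of_subset h.1 h.2.1 h.2.2

/-- Add an item to a sequent. -/
def add (s : Sequent) : Item → Sequent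
  | left A => ⟨A ::ₘ s.ant, s.blk, s.suc⟩
  | block S => ⟨s.ant, S ::ₘ s.blk, s.suc⟩
  | right A => ⟨s.ant, s.blk, A ::ₘ s.suc⟩

theorem items_add (s : Sequent) (i : Item) : (s.add i).items = insert i s.items := by
  ext j
  cases i <;> cases j <;> simp [add, items]

/-- The componentwise union of two sequents. -/
def union (s t : Sequent) : Sequent := ⟨s.ant + t.ant, s.blk + t.blk, s.suc + t.suc⟩

theorem items_union (s t : Sequent) : (s.union t).items = s.items ∪ t.items := by
  ext j
  cases j <;> simp [union, items]

theorem exists_items_eq {F : Set Item} (hF : F.Finite) : ∃ s : Sequent, s.items = F := by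
  induction F, hF using Set.Finite.induction_on with
  | empty => exact ⟨⟨0, 0, 0⟩, by simp [items]⟩
  | insert _ _ ih =>
    obtain ⟨s, rfl⟩ := ih
    exact ⟨s.add _, items_add _ _⟩

end Sequent

/-! ### Maximal coherent sets of sequents and canonical worlds -/

theorem Hypersequent.Le.of_subset {G H : Hypersequent} (h : G ⊆ H) : Hypersequent.Le G H :=
  fun s hs => ⟨s, h hs, .refl s⟩

variable {X : Set ModalAxiom}

/-- No hypersequent with components in `𝓢` is derivable. -/
def Coherent (X : Set ModalAxiom) (𝓢 : Set Sequent) : Prop :=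
  ∀ H : Hypersequent, (∀ s ∈ H, s ∈ 𝓢) → ¬ Derivable (HERule X) H

/-- Coherence has finite character, since a hypersequent has finitely many components. The
components of `H` form a coherent set, because a hypersequent repeating or omitting some of them
reduces to `H` by contraction and weakening. -/
theorem exists_maximal_coherent {H : Hypersequent} (hH : ¬ Derivable (HERule X) H) :
    ∃ 𝓢, (∀ s ∈ H, s ∈ 𝓢) ∧ Maximal (Coherent X) 𝓢 := by
  have hfin : Order.IsOfFiniteCharacter {𝓢 | Coherent X 𝓢} := by
    intro 𝓢
    constructor
    · exact fun h 𝓣 h𝓣 _ G hG => h G fun s hs => h𝓣 (hG s hs)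
    · exact fun h G hG => h (y := {s | s ∈ G}) hG (Multiset.finite_toSet G) G fun s hs => hs
  obtain ⟨𝓢, hle, hmax⟩ := hfin.exists_maximal (x := {s | s ∈ H})
    fun G hG hder => hH (hder.mono (.of_subset fun s hs => hG s hs))
  exact ⟨𝓢, hle, hmax⟩

/-- By maximality, adding `s` makes some hypersequent derivable; its copies of `s` are contracted,
or one is added by weakening. -/
theorem exists_derivable_of_notMem {𝓢 : Set Sequent} (h𝓢 : Maximal (Coherent X) 𝓢) {s : Sequent}
    (hs : s ∉ 𝓢) : ∃ G : Hypersequent, (∀ t ∈ G, t ∈ 𝓢) ∧ Derivable (HERule X) (s ::ₘ G) := by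
  classical
  have h : ¬ Coherent X (insert s 𝓢) := fun h =>
    hs (h𝓢.2 h (Set.subset_insert _ _) (Set.mem_insert _ _))
  simp only [Coherent, not_forall, not_not] at h
  obtain ⟨H, hH, hder⟩ := h
  refine ⟨H.filter (· ≠ s), fun t ht => ?_, hder.mono (.of_subset fun t ht => ?_)⟩
  · rw [Multiset.mem_filter] at ht
    exact (hH t ht.1).resolve_left ht.2
  · by_cases h : t = s <;> simp [h, ht]

/-- All finite sequents contained in `w` belong to `𝓢`. -/
def Within (𝓢 : Set Sequent) (w : Set Item) : Prop := ∀ s : Sequent, s.items ⊆ w → s ∈ 𝓢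

/-- The worlds of the canonical model. -/
abbrev CanonicalWorld (𝓢 : Set Sequent) : Type := {w : Set Item // Maximal (Within 𝓢) w}

section

variable {𝓢 : Set Sequent} (h𝓢 : Maximal (Coherent X) 𝓢)
include h𝓢

theorem mem_of_le {s t : Sequent} (hst : s.Le t) (ht : t ∈ 𝓢) : s ∈ 𝓢 := by
  by_contra hs
  obtain ⟨G, hG, hder⟩ := exists_derivable_of_notMem h𝓢 hs
  exact h𝓢.1 (t ::ₘ G) (by simpa [ht] using hG)
    (hder.mono (.cons hst ((Hypersequent.Le.of_subset fun _ h => h).weaken t)))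

/-- `Within 𝓢` has finite character, since a sequent has finitely many items, and it holds of the
items of `s` because `𝓢` is closed downwards. -/
theorem exists_world {s : Sequent} (hs : s ∈ 𝓢) : ∃ w : CanonicalWorld 𝓢, s.items ⊆ w.1 := by
  have hfin : Order.IsOfFiniteCharacter {w | Within 𝓢 w} := by
    intro w
    constructor
    · exact fun h v hv _ t ht => h t (ht.trans hv)
    · exact fun h t ht => h t.items ht t.items_finite t subset_rfl
  obtain ⟨w, hle, hmax⟩ := hfin.exists_maximal (x := s.items)
    fun t ht => mem_of_le h𝓢 (.of_items ht) hs
  exact ⟨⟨w, hmax⟩, hle⟩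

theorem not_derivable_of_items_subset (w : CanonicalWorld 𝓢) {s : Sequent} (hs : s.items ⊆ w.1)
    {G : Hypersequent} (hG : ∀ t ∈ G, t ∈ 𝓢) : ¬ Derivable (HERule X) (s ::ₘ G) :=
  h𝓢.1 _ (by simpa [w.2.1 s hs] using hG)

/-- By maximality of `w`, some sequent within `w` and `i` lies outside `𝓢`; `s` is that sequent with
`i` removed. -/
theorem exists_derivable_add (w : CanonicalWorld 𝓢) {i : Item} (hi : i ∉ w.1) :
    ∃ (s : Sequent) (G : Hypersequent), s.items ⊆ w.1 ∧ (∀ t ∈ G, t ∈ 𝓢) ∧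
      Derivable (HERule X) (s.add i ::ₘ G) := by
  have h : ¬ Within 𝓢 (insert i w.1) := fun h =>
    hi (w.2.2 h (Set.subset_insert _ _) (Set.mem_insert _ _))
  simp only [Within, not_forall] at h
  obtain ⟨t, ht, ht𝓢⟩ := h
  obtain ⟨s, hs⟩ := Sequent.exists_items_eq (t.items_finite.sdiff (t := {i}))
  obtain ⟨G, hG, hder⟩ := exists_derivable_of_notMem h𝓢 ht𝓢
  refine ⟨s, G, ?_, hG, hder.mono
    (.cons (.of_items ?_) ((Hypersequent.Le.of_subset fun _ h => h).weaken _))⟩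
  · rw [hs]
    exact fun j hj => (ht hj.1).resolve_left hj.2
  · rw [Sequent.items_add, hs]
    intro j hj
    by_cases h : j = i
    · exact .inl h
    · exact .inr ⟨hj, h⟩

/-- Worlds are saturated with respect to rules with two premisses. -/
theorem mem_or_mem_of_rule (w : CanonicalWorld 𝓢) {c : Sequent} (hc : c.items ⊆ w.1) {i j : Item}
    (hr : ∀ (s : Sequent) (G : Hypersequent), c.items ⊆ s.items →
      Derivable (HERule X) (s.add i ::ₘ G) → Derivable (HERule X) (s.add j ::ₘ G) →
      Derivable (HERule X) (s ::ₘ G)) : i ∈ w.1 ∨ j ∈ w.1 := by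
  by_contra! h
  obtain ⟨s₁, G₁, hs₁, hG₁, h₁⟩ := exists_derivable_add h𝓢 w h.1
  obtain ⟨s₂, G₂, hs₂, hG₂, h₂⟩ := exists_derivable_add h𝓢 w h.2
  -- Both derivations are weakened to a common context that contains the principal part `c` and
  -- still lies within `w`, so the rule applies and contradicts coherence.
  refine not_derivable_of_items_subset h𝓢 w (s := c.union (s₁.union s₂)) (G := G₁ + G₂) ?_ ?_
    (hr _ _ ?_ (h₁.mono (.cons (.of_items ?_) (.of_subset ?_)))
      (h₂.mono (.cons (.of_items ?_) (.of_subset ?_))))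
  · simp [Sequent.items_union, hc, hs₁, hs₂]
  · intro t ht
    exact (Multiset.mem_add.1 ht).elim (hG₁ t) (hG₂ t)
  · simp [Sequent.items_union]
  · simp only [Sequent.items_add, Sequent.items_union]
    exact Set.insert_subset_insert fun _ h => .inr (.inl h)
  · intro t ht; simp [ht]
  · simp only [Sequent.items_add, Sequent.items_union]
    exact Set.insert_subset_insert fun _ h => .inr (.inr h)
  · intro t ht; simp [ht]

theorem mem_of_rule (w : CanonicalWorld 𝓢) {c : Sequent} (hc : c.items ⊆ w.1) {i : Item}
    (hr : ∀ (s : Sequent) (G : Hypersequent), c.items ⊆ s.items →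
      Derivable (HERule X) (s.add i ::ₘ G) → Derivable (HERule X) (s ::ₘ G)) : i ∈ w.1 :=
  (mem_or_mem_of_rule h𝓢 w hc fun s G hs h _ => hr s G hs h).elim id id

/-- Rules that create new components give rise to worlds. -/
theorem exists_world_of_rule (w : CanonicalWorld 𝓢) {c : Sequent} (hc : c.items ⊆ w.1)
    (ps : Multiset Sequent)
    (hr : ∀ G : Hypersequent, (∀ p ∈ ps, Derivable (HERule X) (p ::ₘ c ::ₘ G)) →
      Derivable (HERule X) (c ::ₘ G)) : ∃ p ∈ ps, ∃ v : CanonicalWorld 𝓢, p.items ⊆ v.1 := by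
  by_contra! h
  have h' : ∀ p ∈ ps, ∃ G : Hypersequent, (∀ t ∈ G, t ∈ 𝓢) ∧ Derivable (HERule X) (p ::ₘ G) := by
    intro p hp
    refine exists_derivable_of_notMem h𝓢 fun hp𝓢 => ?_
    obtain ⟨v, hv⟩ := exists_world h𝓢 hp𝓢
    exact h p hp v hv
  choose! f hf hder using h'
  -- If no premiss extended to a world, all would be derivable over one joint context, and the rule
  -- would derive `c` over that context although `c` lies within `w`.
  refine not_derivable_of_items_subset h𝓢 w hc (G := (ps.map f).join) ?_
    (hr _ fun p hp => (hder p hp).mono (.of_subset ?_))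
  · intro t ht
    simp only [Multiset.mem_join, Multiset.mem_map] at ht
    obtain ⟨_, ⟨p, hp, rfl⟩, ht⟩ := ht
    exact hf p hp t ht
  · refine Multiset.cons_subset_cons fun t ht => Multiset.mem_cons_of_mem ?_
    exact Multiset.mem_join.2 ⟨f p, Multiset.mem_map_of_mem f hp, ht⟩

end

/-! ### The canonical model -/

/-- The canonical model. A block `Σ` of a world stands for all neighbourhoods between the set of
worlds with `Σ` on the left and, unless `M ∈ X`, the set of worlds with no element of `Σ` on the
right. -/
def canonicalModel (X : Set ModalAxiom) (𝓢 : Set Sequent) : NModel where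
  World := CanonicalWorld 𝓢
  nbhd w := {U | ∃ S, block S ∈ w.1 ∧ (∀ v : CanonicalWorld 𝓢, (∀ A ∈ S, left A ∈ v.1) → v ∈ U) ∧
    (ModalAxiom.M ∉ X → ∀ v ∈ U, ∀ A ∈ S, right A ∉ v.1)}
  val p := {w | left (atom p) ∈ w.1}

section

variable {𝓢 : Set Sequent} (h𝓢 : Maximal (Coherent X) 𝓢)
include h𝓢

theorem right_top_notMem (w : CanonicalWorld 𝓢) : right top ∉ w.1 := fun h =>
  not_derivable_of_items_subset h𝓢 w (s := ⟨0, 0, {top}⟩) (G := 0)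
    (by simpa [Sequent.items_subset] using h) (by simp) (.step _ _ (.topR 0 0 0 0) (by simp))

/-- Induction on `A`, each connective using the saturation given by its left and right rules.
Nothing is claimed about formulas on neither side; deciding those would require cut. -/
theorem canonical_truth (A : Formula) (w : CanonicalWorld 𝓢) :
    (left A ∈ w.1 → w ∈ (canonicalModel X 𝓢).sem A) ∧
      (right A ∈ w.1 → w ∉ (canonicalModel X 𝓢).sem A) := by
  induction A generalizing w with
  | atom p =>
    refine ⟨fun h => h, fun h (h' : left (atom p) ∈ w.1) => ?_⟩
    exact not_derivable_of_items_subset h𝓢 w (s := ⟨{atom p}, 0, {atom p}⟩) (G := 0)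
      (by simpa [Sequent.items_subset] using ⟨h', h⟩) (by simp)
      (.step _ _ (.init 0 0 0 0 p) (by simp))
  | bot =>
    refine ⟨fun h => ?_, fun _ h => h⟩
    exact (not_derivable_of_items_subset h𝓢 w (s := ⟨{bot}, 0, 0⟩) (G := 0)
      (by simpa [Sequent.items_subset] using h) (by simp)
      (.step _ _ (.botL 0 0 0 0) (by simp))).elim
  | top => exact ⟨fun _ => trivial, fun h => (right_top_notMem h𝓢 w h).elim⟩
  | and A B hA hB =>
    constructor
    · intro h
      refine ⟨(hA w).1 ?_, (hB w).1 ?_⟩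
      all_goals
        refine mem_of_rule h𝓢 w (c := ⟨{and A B}, 0, 0⟩) (by simpa [Sequent.items_subset] using h) ?_
        rintro ⟨Γ, Θ, Δ⟩ G hc hd
        obtain ⟨Γ, rfl⟩ := Multiset.exists_cons_of_mem
          (Sequent.left_mem_items.1 (hc (Sequent.left_mem_items.2 (Multiset.mem_singleton_self _))))
        refine .step _ _ (.andL _ _ _ _ A B) ?_
        simp only [Multiset.mem_singleton, forall_eq]
        refine hd.mono (.cons (.of_subset ?_ ?_ ?_)
          ((Hypersequent.Le.of_subset fun _ h => h).weaken _))
        all_goals intro; simp +contextual [Sequent.add, or_imp]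
    · intro h
      suffices right A ∈ w.1 ∨ right B ∈ w.1 from
        fun hw => this.elim (fun h => (hA w).2 h hw.1) fun h => (hB w).2 h hw.2
      refine mem_or_mem_of_rule h𝓢 w (c := ⟨0, 0, {and A B}⟩)
        (by simpa [Sequent.items_subset] using h) ?_
      rintro ⟨Γ, Θ, Δ⟩ G hc hd₁ hd₂
      obtain ⟨Δ, rfl⟩ := Multiset.exists_cons_of_mem
        (Sequent.right_mem_items.1 (hc (Sequent.right_mem_items.2 (Multiset.mem_singleton_self _))))
      exact .step _ _ (.andR _ _ _ _ A B) (by simpa using ⟨hd₁, hd₂⟩)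
  | or A B hA hB =>
    constructor
    · intro h
      suffices left A ∈ w.1 ∨ left B ∈ w.1 from this.imp (hA w).1 (hB w).1
      refine mem_or_mem_of_rule h𝓢 w (c := ⟨{or A B}, 0, 0⟩)
        (by simpa [Sequent.items_subset] using h) ?_
      rintro ⟨Γ, Θ, Δ⟩ G hc hd₁ hd₂
      obtain ⟨Γ, rfl⟩ := Multiset.exists_cons_of_mem
        (Sequent.left_mem_items.1 (hc (Sequent.left_mem_items.2 (Multiset.mem_singleton_self _))))
      exact .step _ _ (.orL _ _ _ _ A B) (by simpa using ⟨hd₁, hd₂⟩)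
    · intro h hw
      refine hw.elim ((hA w).2 ?_) ((hB w).2 ?_)
      all_goals
        refine mem_of_rule h𝓢 w (c := ⟨0, 0, {or A B}⟩) (by simpa [Sequent.items_subset] using h) ?_
        rintro ⟨Γ, Θ, Δ⟩ G hc hd
        obtain ⟨Δ, rfl⟩ := Multiset.exists_cons_of_mem (Sequent.right_mem_items.1
          (hc (Sequent.right_mem_items.2 (Multiset.mem_singleton_self _))))
        refine .step _ _ (.orR _ _ _ _ A B) ?_
        simp only [Multiset.mem_singleton, forall_eq]
        refine hd.mono (.cons (.of_subset ?_ ?_ ?_)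
          ((Hypersequent.Le.of_subset fun _ h => h).weaken _))
        all_goals intro; simp +contextual [Sequent.add, or_imp]
  | imp A B hA hB =>
    constructor
    · intro h
      suffices right A ∈ w.1 ∨ left B ∈ w.1 from
        fun hw => this.elim (fun h => ((hA w).2 h hw).elim) (hB w).1
      refine mem_or_mem_of_rule h𝓢 w (c := ⟨{imp A B}, 0, 0⟩)
        (by simpa [Sequent.items_subset] using h) ?_
      rintro ⟨Γ, Θ, Δ⟩ G hc hd₁ hd₂
      obtain ⟨Γ, rfl⟩ := Multiset.exists_cons_of_mem
        (Sequent.left_mem_items.1 (hc (Sequent.left_mem_items.2 (Multiset.mem_singleton_self _))))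
      exact .step _ _ (.impL _ _ _ _ A B) (by simpa using ⟨hd₁, hd₂⟩)
    · intro h hw
      refine (hB w).2 ?_ (hw ((hA w).1 ?_))
      all_goals
        refine mem_of_rule h𝓢 w (c := ⟨0, 0, {imp A B}⟩) (by simpa [Sequent.items_subset] using h) ?_
        rintro ⟨Γ, Θ, Δ⟩ G hc hd
        obtain ⟨Δ, rfl⟩ := Multiset.exists_cons_of_mem (Sequent.right_mem_items.1
          (hc (Sequent.right_mem_items.2 (Multiset.mem_singleton_self _))))
        refine .step _ _ (.impR _ _ _ _ A B) ?_
        simp only [Multiset.mem_singleton, forall_eq]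
        refine hd.mono (.cons (.of_subset ?_ ?_ ?_)
          ((Hypersequent.Le.of_subset fun _ h => h).weaken _))
        all_goals intro; simp +contextual [Sequent.add]
  | box A hA =>
    constructor
    · intro h
      refine ⟨{A}, ?_, fun v hv => (hA v).1 (hv A (Multiset.mem_singleton_self A)),
        fun _ v hv B hB => ?_⟩
      · refine mem_of_rule h𝓢 w (c := ⟨{box A}, 0, 0⟩)
          (by simpa [Sequent.items_subset] using h) ?_
        rintro ⟨Γ, Θ, Δ⟩ G hc hd
        obtain ⟨Γ, rfl⟩ := Multiset.exists_cons_of_mem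
          (Sequent.left_mem_items.1 (hc (Sequent.left_mem_items.2 (Multiset.mem_singleton_self _))))
        exact .step _ _ (.boxL _ _ _ _ A) (by simpa [Sequent.add] using hd)
      · rw [Multiset.mem_singleton.1 hB]
        exact fun h => (hA v).2 h hv
    -- Suppose the truth set of `A` lies in the interval of `S`. The right box rule yields a world
    -- refuting one of its premisses: `S ⇒ A` breaks the lower bound, `A ⇒ B` with `B ∈ S` the upper
    -- one.
    · rintro h ⟨S, hS, hS₁, hS₂⟩
      have hc : (⟨0, {S}, {box A}⟩ : Sequent).items ⊆ w.1 := by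
        simpa [Sequent.items_subset] using ⟨hS, h⟩
      by_cases hM : ModalAxiom.M ∈ X
      · obtain ⟨p, hp, v, hv⟩ := exists_world_of_rule h𝓢 w hc {⟨S, 0, {A}⟩} fun G hG =>
          .step _ _ (.boxRm G 0 0 0 S A hM) (by simpa using hG)
        rw [Multiset.mem_singleton.1 hp] at hv
        simp only [Sequent.items_subset, Multiset.mem_singleton, forall_eq] at hv
        exact (hA v).2 hv.2.2 (hS₁ v hv.1)
      · obtain ⟨p, hp, v, hv⟩ := exists_world_of_rule h𝓢 w hc
          (⟨S, 0, {A}⟩ ::ₘ S.map fun B => ⟨{A}, 0, {B}⟩) fun G hG =>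
          .step _ _ (.boxR G 0 0 0 S A hM) (by simpa using hG)
        rcases Multiset.mem_cons.1 hp with rfl | hp
        · simp only [Sequent.items_subset, Multiset.mem_singleton, forall_eq] at hv
          exact (hA v).2 hv.2.2 (hS₁ v hv.1)
        · obtain ⟨B, hB, rfl⟩ := Multiset.mem_map.1 hp
          simp only [Sequent.items_subset, Multiset.mem_singleton, forall_eq] at hv
          exact hS₂ hM v ((hA v).1 hv.1) B hB hv.2.2

theorem exists_world_mem_blocks (w : CanonicalWorld 𝓢) (n : ℕ+) (hn : ModalAxiom.RD n ∈ X)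
    (L : Multiset Block) (h₁ : 1 ≤ Multiset.card L) (h₂ : Multiset.card L ≤ (n : ℕ))
    (hL : ∀ S ∈ L, block S ∈ w.1) : ∃ v : CanonicalWorld 𝓢, ∀ A ∈ L.sum, left A ∈ v.1 := by
  obtain ⟨p, hp, v, hv⟩ := exists_world_of_rule h𝓢 w (c := ⟨0, L + 0, 0⟩)
    (by simpa [Sequent.items_subset] using hL) {⟨L.sum, 0, 0⟩} fun G hG =>
    .step _ _ (.ruleDplus G 0 0 0 n L hn h₁ h₂) (by simpa using hG)
  rw [Multiset.mem_singleton.1 hp, Sequent.items_subset] at hv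
  exact ⟨v, hv.1⟩

/-- `M` holds because the upper bound is then dropped; each other condition comes from the rules for
its axiom. -/
theorem canonicalModel_satisfies : (canonicalModel X 𝓢).Satisfies X where
  condM hM := by
    rintro w U V ⟨S, hS, hS₁, _⟩ hUV
    exact ⟨S, hS, fun v hv => hUV (hS₁ v hv), fun h => (h hM).elim⟩
  condC hC := by
    rintro w U V ⟨S, hS, hS₁, hS₂⟩ ⟨T, hT, hT₁, hT₂⟩
    refine ⟨S + T, ?_, fun v hv => ⟨hS₁ v fun A hA => hv A ?_, hT₁ v fun A hA => hv A ?_⟩,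
      fun hM v hv A hA => ?_⟩
    · refine mem_of_rule h𝓢 w (c := ⟨0, {S, T}, 0⟩)
        (by simpa [Sequent.items_subset] using ⟨hS, hT⟩) ?_
      rintro ⟨Γ, Θ, Δ⟩ G hc hd
      simp only [Sequent.items_subset, Sequent.block_mem_items] at hc
      have hS' : S ∈ Θ := hc.2.1 S (by simp)
      have hT' : T ∈ Θ := hc.2.1 T (by simp)
      -- `S` and `T` may be one and the same occurrence in `Θ`, so fresh copies are added for
      -- `ruleC` and contracted afterwards.
      have : Derivable (HERule X) (⟨Γ, S ::ₘ T ::ₘ Θ, Δ⟩ ::ₘ G) := by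
        refine .step _ _ (.ruleC _ _ _ _ S T hC) ?_
        simp only [Multiset.mem_singleton, forall_eq]
        refine hd.mono (.cons (.of_subset ?_ ?_ ?_)
          ((Hypersequent.Le.of_subset fun _ h => h).weaken _))
        all_goals intro; simp +contextual [Sequent.add, or_imp]
      refine this.mono (.cons (.of_subset ?_ ?_ ?_)
        ((Hypersequent.Le.of_subset fun _ h => h).weaken _))
      all_goals intro; simp +contextual [or_imp, hS', hT']
    · exact Multiset.mem_add.2 (.inl hA)
    · exact Multiset.mem_add.2 (.inr hA)
    · exact (Multiset.mem_add.1 hA).elim (hS₂ hM v hv.1 A) (hT₂ hM v hv.2 A)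
  condN hN := by
    intro w
    refine ⟨{top}, ?_, fun v _ => trivial, fun _ v _ A hA => ?_⟩
    · refine mem_of_rule h𝓢 w (c := ⟨0, 0, 0⟩) (by simp [Sequent.items_subset]) ?_
      rintro ⟨Γ, Θ, Δ⟩ G _ hd
      exact .step _ _ (.ruleN _ _ _ _ hN) (by simpa [Sequent.add] using hd)
    · rw [Multiset.mem_singleton.1 hA]
      exact right_top_notMem h𝓢 v
  condT hT := by
    rintro w U ⟨S, hS, hS₁, _⟩
    refine hS₁ w fun A hA => ?_
    refine mem_of_rule h𝓢 w (c := ⟨0, {S}, 0⟩) (by simpa [Sequent.items_subset] using hS) ?_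
    rintro ⟨Γ, Θ, Δ⟩ G hc hd
    obtain ⟨Θ, rfl⟩ := Multiset.exists_cons_of_mem
      (Sequent.block_mem_items.1 (hc (Sequent.block_mem_items.2 (Multiset.mem_singleton_self _))))
    refine .step _ _ (.ruleT _ _ _ _ S hT) ?_
    simp only [Multiset.mem_singleton, forall_eq]
    refine hd.mono (.cons (.of_subset ?_ ?_ ?_)
      ((Hypersequent.Le.of_subset fun _ h => h).weaken _))
    all_goals intro; simp +contextual [Sequent.add, or_imp, hA]
  condP hP := by
    rintro w ⟨S, hS, hS₁, _⟩
    obtain ⟨p, hp, v, hv⟩ := exists_world_of_rule h𝓢 w (c := ⟨0, {S}, 0⟩)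
      (by simpa [Sequent.items_subset] using hS) {⟨S, 0, 0⟩} fun G hG =>
      .step _ _ (.ruleP G 0 0 0 S (.inl hP)) (by simpa using hG)
    rw [Multiset.mem_singleton.1 hp, Sequent.items_subset] at hv
    exact hS₁ v hv.1
  condD hD := by
    rintro w U ⟨S, hS, hS₁, hS₂⟩ ⟨T, hT, hT₁, hT₂⟩
    have hc : (⟨0, S ::ₘ T ::ₘ 0, 0⟩ : Sequent).items ⊆ w.1 := by
      simpa [Sequent.items_subset] using ⟨hS, hT⟩
    have key (v : CanonicalWorld 𝓢) (hv : (⟨S + T, 0, 0⟩ : Sequent).items ⊆ v.1) : False := by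
      rw [Sequent.items_subset] at hv
      exact hT₁ v (fun A hA => hv.1 A (Multiset.mem_add.2 (.inr hA)))
        (hS₁ v fun A hA => hv.1 A (Multiset.mem_add.2 (.inl hA)))
    by_cases hM : ModalAxiom.M ∈ X
    · obtain ⟨p, hp, v, hv⟩ := exists_world_of_rule h𝓢 w hc {⟨S + T, 0, 0⟩} fun G hG =>
        .step _ _ (.ruleDM G 0 0 0 S T hD hM) (by simpa using hG)
      rw [Multiset.mem_singleton.1 hp] at hv
      exact key v hv
    · obtain ⟨p, hp, v, hv⟩ := exists_world_of_rule h𝓢 w hc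
        (⟨S + T, 0, 0⟩ ::ₘ (S ×ˢ T).map fun q => ⟨0, 0, {q.1, q.2}⟩) fun G hG =>
        .step _ _ (.ruleD2 G 0 0 0 S T hD hM) (by
          intro H' hH'
          rcases Multiset.mem_cons.1 hH' with rfl | hH'
          · exact hG _ (Multiset.mem_cons_self _ _)
          · obtain ⟨q, hq, rfl⟩ := Multiset.mem_map.1 hH'
            exact hG _ (Multiset.mem_cons_of_mem (Multiset.mem_map.2 ⟨q, hq, rfl⟩)))
      rcases Multiset.mem_cons.1 hp with rfl | hp
      · exact key v hv
      · obtain ⟨⟨A, B⟩, hAB, rfl⟩ := Multiset.mem_map.1 hp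
        obtain ⟨hA, hB⟩ := Multiset.mem_product.1 hAB
        rw [Sequent.items_subset] at hv
        -- The world has `A ∈ S` and `B ∈ T` on the right, so the upper bounds keep it out of both
        -- `U` and its complement.
        by_cases hvU : v ∈ U
        · exact hS₂ hM v hvU A hA (hv.2.2 A (by simp))
        · exact hT₂ hM v hvU B hB (hv.2.2 B (by simp))
  condRD n hn := by
    intro w L h₁ h₂ hL
    choose! f hf hf₁ _ using hL
    -- Different neighbourhoods may come from one block; `L.map f` repeats it, which keeps the
    -- number of blocks equal to that of neighbourhoods.
    obtain ⟨v, hv⟩ := exists_world_mem_blocks h𝓢 w n hn (L.map f) (by simpa using h₁)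
      (by simpa using h₂) (by simpa using hf)
    exact ⟨v, fun U hU => hf₁ U hU v fun A hA =>
      hv A (Multiset.mem_join.2 ⟨f U, Multiset.mem_map_of_mem f hU, hA⟩)⟩

theorem canonicalModel_not_valid {s : Sequent} (hs : s ∈ 𝓢) : ¬ (canonicalModel X 𝓢).Valid s := by
  obtain ⟨w, hw⟩ := exists_world h𝓢 hs
  rw [Sequent.items_subset] at hw
  intro h
  obtain ⟨A, hA, hwA⟩ := h w (fun A hA => (canonical_truth h𝓢 A w).1 (hw.1 A hA))
    -- By the truth lemma, the truth set of a block lies in the interval of that block.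
    fun S hS => ⟨S, hw.2.1 S hS, fun v hv A hA => (canonical_truth h𝓢 A v).1 (hv A hA),
      fun _ v hv A hA hr => (canonical_truth h𝓢 A v).2 hr (hv A hA)⟩
  exact (canonical_truth h𝓢 A w).2 (hw.2.2 A hA) hwA

end

/-! ### Completeness and cut elimination -/

/-- Completeness of the cut-free calculus. -/
theorem derivable_of_hValid {H : Hypersequent}
    (h : ∀ M : NModel, M.Satisfies X → M.HValid H) : Derivable (HERule X) H := by
  by_contra hH
  obtain ⟨𝓢, hH𝓢, h𝓢⟩ := exists_maximal_coherent hH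
  obtain ⟨s, hs, hv⟩ := h _ (canonicalModel_satisfies h𝓢)
  exact canonicalModel_not_valid h𝓢 (hH𝓢 s hs) hv

theorem Derivable.withCut {H : Hypersequent} (h : Derivable (HERule X) H) :
    Derivable (HECutRule X) H := by
  induction h with
  | step ps H r _ ih => exact .step ps H (.inl r) ih

end NNModal

theorem mainTheorem2 (X : Set NNModal.ModalAxiom) :
    NNModal.Admissible (NNModal.HERule X) NNModal.CutRule ∧
    (∀ H : NNModal.Hypersequent,
      NNModal.Derivable (NNModal.HECutRule X) H → NNModal.Derivable (NNModal.HERule X) H) ∧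
    (∀ A : NNModal.Formula,
      NNModal.Provable X A → NNModal.Derivable (NNModal.HERule X) (NNModal.single A)) := by
  have hcut : ∀ H, NNModal.Derivable (NNModal.HECutRule X) H →
      NNModal.Derivable (NNModal.HERule X) H :=
    fun H h => NNModal.derivable_of_hValid fun M hM => hM.hValid h
  -- Admissibility is cut elimination for a derivation ending in a single cut.
  refine ⟨fun ps H r h => hcut H (.step ps H (.inr r) fun H' hH' => (h H' hH').withCut), hcut,
    fun A h => NNModal.derivable_of_hValid fun M hM => ?_⟩
  exact ⟨⟨0, 0, {A}⟩, Multiset.mem_singleton_self _, fun w _ _ =>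
    ⟨A, Multiset.mem_singleton_self _, hM.mem_sem h w⟩⟩
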